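/- Let $(M,g)$ be a connected, Hausdorff, smooth Riemannian manifold without boundary, either finite-dimensional or, more generally, modelled on a real Hilbert space with $g$ smooth and strong (each $g_p$ induces the topology of $T_pM$), and let $\nabla$ be its Levi-Civita connection. Suppose that $M$ is geodesically complete: for every $p\in M$ and $v\in T_pM$ there is a geodesic $\gamma:\mathbb R\to M$ (a smooth curve with $\nabla_{\dot\gamma}\dot\gamma=0$) with $\gamma(0)=p$ and $\dot\gamma(0)=v$. Let $F$ be a Killing vector field on $M$, that is, a smooth vector field such that $g(\nabla_uF,w)+g(u,\nabla_wF)=0$ for all $p\in M$ and $u,w\in T_pM$ (in index notation, $\nabla_aF_b+\nabla_bF_a=0$). Then $F$ is complete: every maximal integral curve of $F$ is defined on all of $\mathbb R$. -/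

import Mathlib

set_option maxSynthPendingDepth 3

open Set
open scoped Manifold ContDiff Topology

noncomputable section

namespace RiemannianKilling

/-! ### Christoffel symbols of a metric on (an open part of) a vector space -/

section Flat

variable {E : Type*} [NormedAddCommGroup E] [NormedSpace ℝ E]

/-- The Christoffel symbols of the first kind of a metric `z ↦ G z` on `E`:
`Γ(u, v; w) = (∂_u G(v, w) + ∂_v G(u, w) - ∂_w G(u, v)) / 2`, see `christoffelFirst_apply`. -/
def christoffelFirst (G : E → E →L[ℝ] E →L[ℝ] ℝ) (z : E) : E →L[ℝ] E →L[ℝ] E →L[ℝ] ℝ :=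
  let D : E →L[ℝ] E →L[ℝ] E →L[ℝ] ℝ := fderiv ℝ G z
  let T : E →L[ℝ] E →L[ℝ] E →L[ℝ] ℝ :=
    ((ContinuousLinearMap.flipₗᵢ ℝ E E ℝ).toContinuousLinearEquiv :
      (E →L[ℝ] E →L[ℝ] ℝ) →L[ℝ] (E →L[ℝ] E →L[ℝ] ℝ)).comp D.flip
  (1 / 2 : ℝ) • (D + D.flip - T)

theorem christoffelFirst_apply (G : E → E →L[ℝ] E →L[ℝ] ℝ) (z u v w : E) :
    christoffelFirst G z u v w =
      1 / 2 * (fderiv ℝ G z u v w + fderiv ℝ G z v u w - fderiv ℝ G z w u v) := by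
  simp [christoffelFirst]

/-- The Christoffel symbols of the second kind: the index of `christoffelFirst` is raised with the
inverse of the isomorphism `G z` from `E` to its dual, see `christoffel_apply`. -/
def christoffel (G : E → E →L[ℝ] E →L[ℝ] ℝ) (z : E) : E →L[ℝ] E →L[ℝ] E :=
  (ContinuousLinearMap.compL ℝ E (E →L[ℝ] ℝ) E (G z).inverse).comp (christoffelFirst G z)

theorem christoffel_apply (G : E → E →L[ℝ] E →L[ℝ] ℝ) (z u v : E) :
    christoffel G z u v = (G z).inverse (christoffelFirst G z u v) := rfl

end Flat

end RiemannianKilling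

end

open Bundle

noncomputable section

namespace RiemannianKilling

variable {E : Type*} [NormedAddCommGroup E] [NormedSpace ℝ E]
  {M : Type*} [TopologicalSpace M] [ChartedSpace E M] [IsManifold 𝓘(ℝ, E) ∞ M]

/-! ### Coordinates of tangent vectors -/

/-- The coordinates of tangent vectors at `x` in the preferred chart at `c` (the derivative of the
chart), for `x` in the domain of this chart. -/
def toCoord (c x : M) : TangentSpace 𝓘(ℝ, E) x →L[ℝ] E :=
  (trivializationAt E (TangentSpace 𝓘(ℝ, E)) c).continuousLinearMapAt ℝ x

/-- The tangent vector at `x` with given coordinates in the preferred chart at `c`, for `x` in the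
domain of this chart. -/
def ofCoord (c x : M) : E →L[ℝ] TangentSpace 𝓘(ℝ, E) x :=
  (trivializationAt E (TangentSpace 𝓘(ℝ, E)) c).symmL ℝ x

theorem ofCoord_toCoord (x : M) (v : TangentSpace 𝓘(ℝ, E) x) :
    ofCoord x x (toCoord x x v) = v :=
  (trivializationAt E (TangentSpace 𝓘(ℝ, E)) x).symmL_continuousLinearMapAt
    (FiberBundle.mem_baseSet_trivializationAt' x) v

theorem mdifferentiableAt_toCoord {σ : ∀ x : M, TangentSpace 𝓘(ℝ, E) x} {x : M}
    (hσ : MDifferentiableAt 𝓘(ℝ, E) 𝓘(ℝ, E).tangent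
      (fun y ↦ (⟨y, σ y⟩ : TangentBundle 𝓘(ℝ, E) M)) x) :
    MDifferentiableAt 𝓘(ℝ, E) 𝓘(ℝ, E) (fun y ↦ toCoord x y (σ y)) x := by
  refine ((mdifferentiableAt_section 𝓘(ℝ, E) σ).1 hσ).congr_of_eventuallyEq ?_
  filter_upwards [(trivializationAt E (TangentSpace 𝓘(ℝ, E)) x).open_baseSet.mem_nhds
    (FiberBundle.mem_baseSet_trivializationAt' x)] with y hy
  simp only [toCoord, Trivialization.continuousLinearMapAt_apply]
  rw [Trivialization.coe_linearMapAt_of_mem _ hy]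

/-- The velocity `γ'(t)` of a curve. -/
def velocity (γ : ℝ → M) (t : ℝ) : TangentSpace 𝓘(ℝ, E) (γ t) :=
  mfderiv 𝓘(ℝ, ℝ) 𝓘(ℝ, E) γ t (1 : ℝ)

/-! ### Complete vector fields -/

/-- `γ`, restricted to `s`, is a maximal integral curve of `F`: `s` is a nonempty open interval,
`γ` is an integral curve of `F` on `s`, and it does not extend to an integral curve on a larger
open interval. (The values of `γ` outside `s` are irrelevant.) -/
structure IsMaximalIntegralCurve (F : ∀ x : M, TangentSpace 𝓘(ℝ, E) x) (γ : ℝ → M)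
    (s : Set ℝ) : Prop where
  isOpen : IsOpen s
  ordConnected : s.OrdConnected
  nonempty : s.Nonempty
  isIntegralCurve : IsMIntegralCurveOn γ F s
  maximal : ∀ (δ : ℝ → M) (t : Set ℝ), IsOpen t → t.OrdConnected → IsMIntegralCurveOn δ F t →
    s ⊆ t → EqOn γ δ s → t = s

/-- A vector field is complete if every maximal integral curve has domain `ℝ`. -/
def IsCompleteVectorField (F : ∀ x : M, TangentSpace 𝓘(ℝ, E) x) : Prop :=
  ∀ (γ : ℝ → M) (s : Set ℝ), IsMaximalIntegralCurve F γ s → s = univ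

/-! ### The Levi-Civita connection -/

variable [RiemannianBundle (fun x : M ↦ TangentSpace 𝓘(ℝ, E) x)]

/-- The coordinate expression of the Riemannian metric in the preferred chart at `c`. -/
def metricInChart (c : M) (z : E) : E →L[ℝ] E →L[ℝ] ℝ :=
  (innerSL ℝ (E := TangentSpace 𝓘(ℝ, E) ((extChartAt 𝓘(ℝ, E) c).symm z))
    : _ →L[ℝ] _ →L[ℝ] ℝ).bilinearComp (ofCoord c _) (ofCoord c _)

theorem metricInChart_apply (c : M) (z u v : E) :
    metricInChart c z u v = inner ℝ (ofCoord c ((extChartAt 𝓘(ℝ, E) c).symm z) u)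
      (ofCoord c ((extChartAt 𝓘(ℝ, E) c).symm z) v) := rfl

/-- The Christoffel symbols at the point `x`, in the preferred chart at `x`. -/
def christoffelAt (x : M) : E →L[ℝ] E →L[ℝ] E :=
  christoffel (metricInChart x) (extChartAt 𝓘(ℝ, E) x x)

variable (E M) in
/-- The Levi-Civita connection. At the point `x`, in the preferred chart at `x`,
`∇_u σ = ∂_u σ + Γ(u, σ)`. -/
def leviCivita : CovariantDerivative 𝓘(ℝ, E) E (TangentSpace 𝓘(ℝ, E) : M → Type _) where
  toFun σ x := (ofCoord x x).comp
    (mvfderiv 𝓘(ℝ, E) (fun y ↦ toCoord x y (σ y)) x +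
      ((christoffelAt x).flip (toCoord x x (σ x))).comp (toCoord x x))
  isCovariantDerivativeOnUniv := by
    constructor
    · intro σ σ' x hσ hσ' _
      have h := mvfderiv_add (mdifferentiableAt_toCoord hσ) (mdifferentiableAt_toCoord hσ')
      have e : (fun y ↦ toCoord x y ((σ + σ') y)) =
        (fun y ↦ toCoord x y (σ y)) + (fun y ↦ toCoord x y (σ' y)) := by
        ext y; simp
      rw [e, h]
      ext v
      simp
      abel
    · intro σ g x hσ hg _
      have h := mvfderiv_smul hg (mdifferentiableAt_toCoord hσ)
      have e : (fun y ↦ toCoord x y ((g • σ) y)) =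
        g • (fun y ↦ toCoord x y (σ y)) := by
        ext y; simp
      rw [e, h]
      ext v
      simp [ofCoord_toCoord]
      abel

/-- The covariant derivative along a curve `γ` of a vector field `V` along `γ`. At time `t`, in the
preferred chart at `γ t`, it is `V' + Γ(γ', V)`. -/
def covDerivAlong (γ : ℝ → M) (V : ∀ t, TangentSpace 𝓘(ℝ, E) (γ t)) (t : ℝ) :
    TangentSpace 𝓘(ℝ, E) (γ t) :=
  ofCoord (γ t) (γ t)
    (deriv (fun s ↦ toCoord (γ t) (γ s) (V s)) t +
      christoffelAt (γ t) (toCoord (γ t) (γ t) (velocity γ t)) (toCoord (γ t) (γ t) (V t)))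

/-! ### Geodesic completeness and Killing fields -/

variable (E) in
/-- A (globally defined) geodesic: a smooth curve `γ : ℝ → M` with `∇_{γ'} γ' = 0`. -/
structure IsGeodesic (γ : ℝ → M) : Prop where
  contMDiff : ContMDiff 𝓘(ℝ, ℝ) 𝓘(ℝ, E) ∞ γ
  covDerivAlong_velocity : ∀ t, covDerivAlong γ (velocity (E := E) γ) t = 0

variable (E M) in
/-- Geodesic completeness: for every point `p` and every tangent vector `v` at `p`, the geodesic
which starts at `p` with velocity `v` is defined on all of `ℝ`. -/
def GeodesicallyComplete : Prop :=
  ∀ ξ : TangentBundle 𝓘(ℝ, E) M, ∃ γ : ℝ → M,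
    IsGeodesic E γ ∧ (⟨γ 0, velocity γ 0⟩ : TangentBundle 𝓘(ℝ, E) M) = ξ

/-- A Killing field: a smooth vector field `F` with `∇_a F_b + ∇_b F_a = 0`. Here
`∇_a F_b u^a w^b = g(∇_u F, w)`. -/
structure IsKillingField (F : ∀ x : M, TangentSpace 𝓘(ℝ, E) x) : Prop where
  contMDiff : ContMDiff 𝓘(ℝ, E) 𝓘(ℝ, E).tangent ∞
    (fun x ↦ (⟨x, F x⟩ : TangentBundle 𝓘(ℝ, E) M))
  killing_equation : ∀ (x : M) (u w : TangentSpace 𝓘(ℝ, E) x),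
    inner ℝ (leviCivita E M F x u) w + inner ℝ (leviCivita E M F x w) u = 0

end RiemannianKilling

end

/-! The obstruction to completeness is that the existence time of integral curves of `F` might
shrink from point to point. It is propagated along geodesics. The natural place for this is the
tangent bundle, where the geodesics are the integral curves of the spray S and `F` has its complete
lift F^c, the infinitesimal form of the differential of its flow. The Killing equation says that the
Lie derivative of the metric along `F` vanishes; hence so does that of the Christoffel symbols
(`lieDeriv_christoffel_eq_zero`), which is the statement that S and F^c commute
(`fderiv_spray_completeLift`). As S is complete, its flow Φ_s is globally defined and carries
integral curves of F^c to integral curves of F^c on the same time interval (`preservesAt`). So the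
set of tangent vectors whose F^c-curve lives on (-ε, ε), `liftDomain`, is invariant under the
geodesic flow.

F^c is linear on fibres over integral curves of `F`, so as soon as `liftDomain` is a neighbourhood
of one vector ξ it contains all fibres over a neighbourhood of its base point
(`eventually_forall_mem_liftDomain`). Fix ε from local existence at one zero vector, and let G be
the interior of the set of points whose whole fibre lies in `liftDomain`. Then G is open and
nonempty, and its complement is closed and invariant under geodesics: a geodesic from the complement
into G could be run backwards, on a whole neighbourhood of initial vectors, to put its starting
point into G.

Finally, a closed set that contains every geodesic through each of its points is open
(`isOpen_of_isClosed_of_flow_invariant`). The proof shoots a short geodesic from an almost nearest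
point of the set towards a point outside and lands closer than the distance to the set allows. It
needs neither Hopf–Rinow, which fails in infinite dimension, nor a nearest point. By connectedness G
is everything, so all integral curves of `F` exist for the uniform time ε, and `F` is complete. -/

noncomputable section

namespace RiemannianKilling

/-! ### Commuting vector fields and local flows on a Banach space -/

section BanachODE

open Metric
open scoped NNReal

variable {V : Type*} [NormedAddCommGroup V] [NormedSpace ℝ V]

theorem gronwallBound_eq_linear (δ K ε x : ℝ) :
    gronwallBound δ K ε x = δ * Real.exp (K * x) + ε * gronwallBound 0 K 1 x := by
  by_cases hK : K = 0
  · subst hK; simp [gronwallBound_K0]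
  · simp only [gronwallBound_of_K_ne_0 hK]; ring

/-- The local flow of a `C¹` vector field, staying in a given neighbourhood. -/
theorem exists_localFlow [CompleteSpace V] {f : V → V} {z₀ : V} (hf : ContDiffAt ℝ 1 f z₀)
    {W : Set V} (hW : W ∈ 𝓝 z₀) :
    ∃ α : V × ℝ → V, ∃ U, IsOpen U ∧ z₀ ∈ U ∧ ∃ ε > 0,
      ContinuousOn α (U ×ˢ Ioo (-ε) ε) ∧ ∀ z ∈ U, α (z, 0) = z ∧
        ∀ t ∈ Ioo (-ε) ε, HasDerivAt (fun s ↦ α (z, s)) (f (α (z, t))) t ∧ α (z, t) ∈ W := by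
  obtain ⟨ε, hε, a, r, L, K, hr, hpl⟩ := IsPicardLindelof.of_contDiffAt_one hf
  obtain ⟨α, hα, hc⟩ :=
    (hpl 0).exists_forall_mem_closedBall_eq_hasDerivWithinAt_continuousOn
  simp only [zero_sub, zero_add] at hα hc
  have hn : closedBall z₀ (r : ℝ) ×ˢ Icc (-ε) ε ∈ 𝓝 (z₀, (0 : ℝ)) :=
    prod_mem_nhds (closedBall_mem_nhds _ (by exact_mod_cast hr)) (Icc_mem_nhds (by linarith) hε)
  have hz₀ : α (z₀, 0) = z₀ := (hα z₀ (mem_closedBall_self r.2)).1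
  -- Joint continuity at (z₀, 0) permits shrinking both the initial set and the time interval until
  -- the flow stays in `W`.
  have hpre : α ⁻¹' W ∈ 𝓝 (z₀, (0 : ℝ)) :=
    (hc.continuousAt hn).preimage_mem_nhds (by rwa [hz₀])
  obtain ⟨U₁, hU₁, T, hT, hUT⟩ := mem_nhds_prod_iff.1 (Filter.inter_mem hn hpre)
  obtain ⟨U, hUU, hUo, hzU⟩ := _root_.mem_nhds_iff.1 hU₁
  obtain ⟨e, he, heT⟩ := Metric.mem_nhds_iff.1 hT
  rw [Real.ball_eq_Ioo, zero_sub, zero_add] at heT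
  have key : ∀ z ∈ U, ∀ t ∈ Ioo (-e) e, (z, t) ∈ (closedBall z₀ (r : ℝ) ×ˢ Icc (-ε) ε) ∩ α ⁻¹' W :=
    fun z hz t ht ↦ hUT ⟨hUU hz, heT ht⟩
  refine ⟨α, U, hUo, hzU, min e ε, lt_min he hε, ?_, fun z hz ↦ ?_⟩
  · refine hc.mono ?_
    rintro ⟨z, t⟩ ⟨hz, ht⟩
    exact (key z hz t ⟨by have := min_le_left e ε; linarith [ht.1],
      ht.2.trans_le (min_le_left _ _)⟩).1
  · have h0 := (key z hz 0 ⟨by linarith, he⟩).1.1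
    refine ⟨(hα z h0).1, fun t ht ↦ ?_⟩
    have h1 : t ∈ Ioo (-e) e := ⟨by have := min_le_left e ε; linarith [ht.1],
      ht.2.trans_le (min_le_left _ _)⟩
    have h2 : t ∈ Ioo (-ε) ε := ⟨by have := min_le_right e ε; linarith [ht.1],
      ht.2.trans_le (min_le_right _ _)⟩
    exact ⟨((hα z h0).2 t ⟨h2.1.le, h2.2.le⟩).hasDerivAt (Icc_mem_nhds h2.1 h2.2),
      (key z hz t h1).2⟩

theorem norm_image_sub_sub_le_of_lipschitz_fderiv {f : V → V} {B : Set V} (hB : Convex ℝ B)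
    (hd : ∀ z ∈ B, DifferentiableAt ℝ f z) {L : ℝ}
    (hL : ∀ z ∈ B, ∀ w ∈ B, ‖fderiv ℝ f z - fderiv ℝ f w‖ ≤ L * ‖z - w‖) (hL0 : 0 ≤ L)
    {x y : V} (hx : x ∈ B) (hy : y ∈ B) :
    ‖f y - f x - fderiv ℝ f x (y - x)‖ ≤ L * ‖y - x‖ ^ 2 := by
  have hseg : segment ℝ x y ⊆ B := hB.segment_subset hx hy
  have := (convex_segment x y).norm_image_sub_le_of_norm_fderiv_le' (f := f)
    (φ := fderiv ℝ f x) (C := L * ‖y - x‖) (fun z hz ↦ hd z (hseg hz)) (fun z hz ↦ ?_)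
    (left_mem_segment ℝ x y) (right_mem_segment ℝ x y)
  · calc _ ≤ _ := this
      _ = _ := by ring
  · refine (hL z (hseg hz) x hx).trans ?_
    gcongr
    rw [← dist_eq_norm, ← dist_eq_norm, dist_comm y x, dist_comm z x]
    obtain ⟨θ, hθ, rfl⟩ := (segment_eq_image_lineMap ℝ x y) ▸ hz
    rw [dist_left_lineMap, Real.norm_of_nonneg hθ.1]
    exact mul_le_of_le_one_left dist_nonneg hθ.2

/-- If two vector fields `f` and `g` commute, then the flow of `f` maps curves with velocity `g` to
curves with velocity `g`. Forward in time. -/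
theorem hasDerivAt_localFlow_of_nonneg {f g : V → V} {z₀ : V} {R : ℝ} {K : ℝ≥0} {L C : ℝ}
    (hfK : LipschitzOnWith K f (ball z₀ R))
    (hfd : ∀ z ∈ ball z₀ R, DifferentiableAt ℝ f z)
    (hfL : ∀ z ∈ ball z₀ R, ∀ w ∈ ball z₀ R, ‖fderiv ℝ f z - fderiv ℝ f w‖ ≤ L * ‖z - w‖)
    (hL0 : 0 ≤ L) (hgd : ∀ z ∈ ball z₀ R, DifferentiableAt ℝ g z)
    (hgC : ∀ z ∈ ball z₀ R, ‖g z‖ ≤ C)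
    (hcomm : ∀ z ∈ ball z₀ R, fderiv ℝ f z (g z) = fderiv ℝ g z (f z))
    {α : V × ℝ → V} {U : Set V} (hU : IsOpen U) {ε : ℝ}
    (hα : ∀ z ∈ U, α (z, 0) = z ∧ ∀ t ∈ Ioo (-ε) ε,
      HasDerivAt (fun s ↦ α (z, s)) (f (α (z, t))) t ∧ α (z, t) ∈ ball z₀ (R / 2))
    {a : ℝ → V} {t₀ : ℝ} (ha : HasDerivAt a (g (a t₀)) t₀) (haU : a t₀ ∈ U)
    {s : ℝ} (hs : 0 ≤ s) (hsε : s < ε) :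
    HasDerivAt (fun t ↦ α (a t, s)) (g (α (a t₀, s))) t₀ := by
  have hε : 0 < ε := hs.trans_lt hsε
  have hRpos : 0 < R := by
    have := ((hα _ haU).2 0 ⟨by linarith, hε⟩).2
    have := (Metric.nonempty_ball.1 ⟨_, this⟩)
    linarith
  have hRR : ball z₀ (R / 2) ⊆ ball z₀ R := ball_subset_ball (by linarith)
  have hI : ∀ u ∈ Icc 0 s, u ∈ Ioo (-ε) ε := fun u hu ↦ ⟨by linarith [hu.1], by linarith [hu.2]⟩
  have hC0 : 0 ≤ C := (norm_nonneg _).trans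
    (hgC _ (mem_ball_self hRpos))
  set σ : ℝ → V := fun u ↦ α (a t₀, u) with hσ
  have hσd : ∀ u ∈ Icc 0 s, HasDerivAt σ (f (σ u)) u := fun u hu ↦ ((hα _ haU).2 u (hI u hu)).1
  have hσm : ∀ u ∈ Icc 0 s, σ u ∈ ball z₀ (R / 2) := fun u hu ↦ ((hα _ haU).2 u (hI u hu)).2
  have hUn : ∀ᶠ t in 𝓝 t₀, a t ∈ U := ha.continuousAt.preimage_mem_nhds (hU.mem_nhds haU)
  have hsmall : ∀ᶠ t in 𝓝 t₀, |t - t₀| * C < R / 2 := by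
    have : Filter.Tendsto (fun t ↦ |t - t₀| * C) (𝓝 t₀) (𝓝 (|t₀ - t₀| * C)) :=
      Continuous.tendsto (by fun_prop) t₀
    simp only [sub_self, abs_zero, zero_mul] at this
    exact this.eventually_lt_const (by linarith)
  set A := Real.exp (K * s)
  set G := gronwallBound 0 K 1 s
  -- Differentiability of the flow in its initial value is not used. The curve `q` below, σ
  -- displaced by (t - t₀) g(σ), solves the equation of `f` up to an error quadratic in t - t₀:
  -- `hcomm` identifies its velocity with the linearisation of `f` at σ. Grönwall then compares it
  -- with the true trajectory from `a t`. The initial error is o(t - t₀), and the bound is linear in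
  -- both errors.
  have bound : ∀ᶠ t in 𝓝 t₀, ‖α (a t, s) - σ s - (t - t₀) • g (σ s)‖ ≤
      ‖a t - a t₀ - (t - t₀) • g (a t₀)‖ * A + L * C ^ 2 * |t - t₀| ^ 2 * G := by
    filter_upwards [hUn, hsmall] with t htU ht
    set q : ℝ → V := fun u ↦ σ u + (t - t₀) • g (σ u) with hq
    have hqσ : ∀ u ∈ Icc 0 s, ‖q u - σ u‖ ≤ |t - t₀| * C := fun u hu ↦ by
      simp only [hq, add_sub_cancel_left, norm_smul, Real.norm_eq_abs]
      gcongr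
      exact hgC _ (hRR (hσm u hu))
    have hqm : ∀ u ∈ Icc 0 s, q u ∈ ball z₀ R := fun u hu ↦ by
      have h1 := hσm u hu
      have h2 := hqσ u hu
      rw [mem_ball, dist_eq_norm] at h1 ⊢
      have h3 : q u - z₀ = (q u - σ u) + (σ u - z₀) := by abel
      rw [h3]
      linarith [norm_add_le (q u - σ u) (σ u - z₀)]
    have hqd : ∀ u ∈ Icc 0 s, HasDerivAt q
        (f (σ u) + (t - t₀) • fderiv ℝ f (σ u) (g (σ u))) u := fun u hu ↦ by
      rw [hcomm _ (hRR (hσm u hu))]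
      have h1 : HasDerivAt (fun u ↦ g (σ u)) (fderiv ℝ g (σ u) (f (σ u))) u :=
        (hgd _ (hRR (hσm u hu))).hasFDerivAt.comp_hasDerivAt u (hσd u hu)
      exact (hσd u hu).add (h1.const_smul (t - t₀))
    have hgr := dist_le_of_approx_trajectories_ODE_of_mem (v := fun _ ↦ f) (K := K)
      (s := fun _ ↦ ball z₀ R) (a := 0) (b := s) (f := fun u ↦ α (a t, u)) (g := q)
      (f' := fun u ↦ f (α (a t, u)))
      (g' := fun u ↦ f (σ u) + (t - t₀) • fderiv ℝ f (σ u) (g (σ u)))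
      (εf := 0) (εg := L * C ^ 2 * |t - t₀| ^ 2) (δ := ‖a t - a t₀ - (t - t₀) • g (a t₀)‖)
      (fun _ _ ↦ hfK)
      (fun u hu ↦ ((hα _ htU).2 u (hI u hu)).1.continuousAt.continuousWithinAt)
      (fun u hu ↦ ((hα _ htU).2 u (hI u (Ico_subset_Icc_self hu))).1.hasDerivWithinAt)
      (fun u hu ↦ by simp)
      (fun u hu ↦ hRR ((hα _ htU).2 u (hI u (Ico_subset_Icc_self hu))).2)
      (fun u hu ↦ (hqd u hu).continuousAt.continuousWithinAt)
      (fun u hu ↦ (hqd u (Ico_subset_Icc_self hu)).hasDerivWithinAt)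
      (fun u hu ↦ ?_) (fun u hu ↦ hqm u (Ico_subset_Icc_self hu)) ?_ s ⟨hs, le_rfl⟩
    · rw [zero_add, sub_zero, gronwallBound_eq_linear, dist_eq_norm, hq] at hgr
      rwa [sub_sub]
    · have hu' := Ico_subset_Icc_self hu
      have h1 := norm_image_sub_sub_le_of_lipschitz_fderiv (convex_ball z₀ R) hfd hfL hL0
        (hRR (hσm u hu')) (hqm u hu')
      have h2 : fderiv ℝ f (σ u) (q u - σ u) = (t - t₀) • fderiv ℝ f (σ u) (g (σ u)) := by
        simp [hq]
      rw [h2] at h1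
      rw [dist_comm, dist_eq_norm, ← sub_sub]
      refine h1.trans ?_
      have h3 := hqσ u hu'
      calc L * ‖q u - σ u‖ ^ 2 ≤ L * (|t - t₀| * C) ^ 2 := by gcongr
        _ = _ := by ring
    · simp only [hq, hσ, (hα _ htU).1, (hα _ haU).1, dist_eq_norm]
      rw [sub_sub]
  rw [hasDerivAt_iff_isLittleO] at ha ⊢
  have h1 : (fun t ↦ ‖a t - a t₀ - (t - t₀) • g (a t₀)‖ * A + L * C ^ 2 * |t - t₀| ^ 2 * G)
      =o[𝓝 t₀] fun t ↦ t - t₀ := by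
    refine Asymptotics.IsLittleO.add ?_ ?_
    · have := ha.norm_left.const_mul_left A
      simpa [mul_comm] using this
    · have h3 : (fun t : ℝ ↦ |t - t₀| ^ 2) =o[𝓝 t₀] fun t ↦ t - t₀ := by
        have h4 : (fun x : ℝ ↦ x ^ 2) =o[𝓝 0] fun x ↦ x := Asymptotics.isLittleO_pow_id one_lt_two
        have h5 : Filter.Tendsto (fun t : ℝ ↦ t - t₀) (𝓝 t₀) (𝓝 0) := by
          have : Filter.Tendsto (fun t : ℝ ↦ t - t₀) (𝓝 t₀) (𝓝 (t₀ - t₀)) :=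
            Continuous.tendsto (by fun_prop) t₀
          simpa using this
        simpa [Function.comp_def, sq_abs] using h4.comp_tendsto h5
      have := h3.const_mul_left (L * C ^ 2 * G)
      refine this.congr_left fun t ↦ by ring
  refine Asymptotics.IsBigO.trans_isLittleO ?_ h1
  refine Asymptotics.IsBigO.of_bound 1 ?_
  filter_upwards [bound] with t ht
  rw [one_mul]
  exact ht.trans (le_abs_self _)

/-- If two vector fields `f` and `g` commute, then the flow of `f` maps curves with velocity `g` to
curves with velocity `g`. -/
theorem hasDerivAt_localFlow {f g : V → V} {z₀ : V} {R : ℝ} {K : ℝ≥0} {L C : ℝ}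
    (hfK : LipschitzOnWith K f (ball z₀ R))
    (hfd : ∀ z ∈ ball z₀ R, DifferentiableAt ℝ f z)
    (hfL : ∀ z ∈ ball z₀ R, ∀ w ∈ ball z₀ R, ‖fderiv ℝ f z - fderiv ℝ f w‖ ≤ L * ‖z - w‖)
    (hL0 : 0 ≤ L) (hgd : ∀ z ∈ ball z₀ R, DifferentiableAt ℝ g z)
    (hgC : ∀ z ∈ ball z₀ R, ‖g z‖ ≤ C)
    (hcomm : ∀ z ∈ ball z₀ R, fderiv ℝ f z (g z) = fderiv ℝ g z (f z))
    {α : V × ℝ → V} {U : Set V} (hU : IsOpen U) {ε : ℝ}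
    (hα : ∀ z ∈ U, α (z, 0) = z ∧ ∀ t ∈ Ioo (-ε) ε,
      HasDerivAt (fun s ↦ α (z, s)) (f (α (z, t))) t ∧ α (z, t) ∈ ball z₀ (R / 2))
    {a : ℝ → V} {t₀ : ℝ} (ha : HasDerivAt a (g (a t₀)) t₀) (haU : a t₀ ∈ U)
    {s : ℝ} (hs : s ∈ Ioo (-ε) ε) :
    HasDerivAt (fun t ↦ α (a t, s)) (g (α (a t₀, s))) t₀ := by
  rcases le_total 0 s with h | h
  · exact hasDerivAt_localFlow_of_nonneg hfK hfd hfL hL0 hgd hgC hcomm hU hα ha haU h hs.2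
  -- Negative times: reverse time, which replaces `f` by `-f` and keeps the commutation relation.
  · have := hasDerivAt_localFlow_of_nonneg (f := fun z ↦ -f z) (g := g) (z₀ := z₀) (R := R)
      (K := K) (L := L) (C := C) (α := fun p ↦ α (p.1, -p.2)) (ε := ε) (a := a) (t₀ := t₀)
      (s := -s) hfK.neg (fun z hz ↦ (hfd z hz).neg) (fun z hz w hw ↦ ?_) hL0 hgd hgC
      (fun z hz ↦ ?_) hU (fun z hz ↦ ?_) ha haU (by linarith) (by linarith [hs.1])
    · simpa using this
    · have := hfL w hw z hz
      simp only [fderiv_fun_neg]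
      rw [norm_sub_rev w z] at this
      calc _ = ‖fderiv ℝ f w - fderiv ℝ f z‖ := by congr 1; abel
        _ ≤ _ := this
    · simp [fderiv_fun_neg, hcomm z hz]
    · refine ⟨by simpa using (hα z hz).1, fun t ht ↦ ?_⟩
      have h1 := (hα z hz).2 (-t) ⟨by linarith [ht.2], by linarith [ht.1]⟩
      refine ⟨?_, h1.2⟩
      have := h1.1.scomp t (hasDerivAt_neg t)
      simpa [Function.comp_def] using this

end BanachODE

/-! ### Vector fields given by their expressions in an atlas, and their flows -/

section Atlas

variable {ι N V : Type*} [TopologicalSpace N] [NormedAddCommGroup V] [NormedSpace ℝ V]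
  {χ : ι → OpenPartialHomeomorph N V} {X Y : ι → V → V}

/-- The coordinate expressions `Y i` in the charts `χ i` define a `C²` vector field. -/
structure IsVectorField (χ : ι → OpenPartialHomeomorph N V) (Y : ι → V → V) : Prop where
  contDiffOn : ∀ i, ContDiffOn ℝ 2 (Y i) (χ i).target
  compat : ∀ i j n, n ∈ (χ i).source → n ∈ (χ j).source → ∃ L : V →L[ℝ] V,
    HasFDerivAt (χ j ∘ (χ i).symm) L (χ i n) ∧ L (Y i (χ i n)) = Y j (χ j n)

/-- At time `t`, the velocity of the curve `α` is given by the vector field `Y`. -/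
def IsSolAt (χ : ι → OpenPartialHomeomorph N V) (Y : ι → V → V) (α : ℝ → N) (t : ℝ) : Prop :=
  ContinuousAt α t ∧ ∃ i, α t ∈ (χ i).source ∧ HasDerivAt (χ i ∘ α) (Y i (χ i (α t))) t

theorem IsVectorField.contDiffAt (hY : IsVectorField χ Y) {i : ι} {z : V}
    (hz : z ∈ (χ i).target) : ContDiffAt ℝ 2 (Y i) z :=
  (hY.contDiffOn i).contDiffAt ((χ i).open_target.mem_nhds hz)

theorem IsVectorField.hasDerivAt (hY : IsVectorField χ Y) {α : ℝ → N} {t : ℝ}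
    (h : IsSolAt χ Y α t) {j : ι} (hj : α t ∈ (χ j).source) :
    HasDerivAt (χ j ∘ α) (Y j (χ j (α t))) t := by
  obtain ⟨hc, i, hi, hd⟩ := h
  obtain ⟨L, hL, hLY⟩ := hY.compat i j (α t) hi hj
  rw [← hLY]
  refine (hL.comp_hasDerivAt t hd).congr_of_eventuallyEq ?_
  filter_upwards [hc.preimage_mem_nhds ((χ i).open_source.mem_nhds hi)] with s hs
  simp only [Function.comp_apply]
  rw [(χ i).left_inv hs]

theorem IsSolAt.congr_of_eventuallyEq {α β : ℝ → N} {t : ℝ} (h : IsSolAt χ Y α t)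
    (hβ : β =ᶠ[𝓝 t] α) : IsSolAt χ Y β t := by
  obtain ⟨hc, i, hi, hd⟩ := h
  refine ⟨hc.congr hβ.symm, i, by rwa [hβ.eq_of_nhds], ?_⟩
  rw [hβ.eq_of_nhds]
  exact hd.congr_of_eventuallyEq (hβ.fun_comp (χ i))

theorem IsSolAt.comp_add {α : ℝ → N} {t s : ℝ} (h : IsSolAt χ Y α (t + s)) :
    IsSolAt χ Y (fun u ↦ α (u + s)) t := by
  obtain ⟨hc, i, hi, hd⟩ := h
  refine ⟨ContinuousAt.comp (f := fun u ↦ u + s) hc (by fun_prop), i, hi, ?_⟩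
  exact hd.comp_add_const t s

theorem isSolAt_symm_comp {i : ι} {σ : ℝ → V} {t : ℝ} (hσ : HasDerivAt σ (Y i (σ t)) t)
    (ht : σ t ∈ (χ i).target) : IsSolAt χ Y (fun s ↦ (χ i).symm (σ s)) t := by
  refine ⟨ContinuousAt.comp (f := σ) ((χ i).continuousAt_symm ht) hσ.continuousAt, i,
    (χ i).map_target ht, ?_⟩
  rw [(χ i).right_inv ht]
  refine hσ.congr_of_eventuallyEq ?_
  filter_upwards [hσ.continuousAt.preimage_mem_nhds ((χ i).open_target.mem_nhds ht)] with s hs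
  exact (χ i).right_inv hs

theorem IsVectorField.eventuallyEq (hY : IsVectorField χ Y) {α β : ℝ → N} {t : ℝ}
    (hα : ∀ᶠ s in 𝓝 t, IsSolAt χ Y α s) (hβ : ∀ᶠ s in 𝓝 t, IsSolAt χ Y β s)
    (h : α t = β t) : α =ᶠ[𝓝 t] β := by
  obtain ⟨hcα, i, hi, -⟩ := hα.self_of_nhds
  have hcβ := hβ.self_of_nhds.1
  have hi' : β t ∈ (χ i).source := h ▸ hi
  obtain ⟨K, S, hS, hK⟩ := ((hY.contDiffAt ((χ i).map_source hi)).of_le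
    one_le_two).exists_lipschitzOnWith
  have aux : ∀ γ : ℝ → N, ContinuousAt γ t → γ t = α t → (∀ᶠ s in 𝓝 t, IsSolAt χ Y γ s) →
      ∀ᶠ s in 𝓝 t, HasDerivAt (χ i ∘ γ) (Y i ((χ i ∘ γ) s)) s ∧ (χ i ∘ γ) s ∈ S := by
    intro γ hγ hγt hγs
    have hs : γ t ∈ (χ i).source := hγt ▸ hi
    filter_upwards [hγs, hγ.preimage_mem_nhds ((χ i).open_source.mem_nhds hs),
      (((χ i).continuousAt hs).comp hγ).preimage_mem_nhds (by
        simpa only [Function.comp_apply, hγt] using hS)] with s h1 h2 h3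
    exact ⟨hY.hasDerivAt h1 h2, h3⟩
  have heq := ODE_solution_unique_of_eventually (v := fun _ ↦ Y i) (s := fun _ ↦ S)
    (Filter.Eventually.of_forall fun _ ↦ hK) (aux α hcα rfl hα) (aux β hcβ h.symm hβ)
    (by simp [h])
  filter_upwards [heq, hcα.preimage_mem_nhds ((χ i).open_source.mem_nhds hi),
    hcβ.preimage_mem_nhds ((χ i).open_source.mem_nhds hi')] with s h1 h2 h3
  exact (χ i).injOn h2 h3 h1

theorem IsVectorField.eqOn [T2Space N] (hY : IsVectorField χ Y) {α β : ℝ → N} {J : Set ℝ}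
    (hJ : IsOpen J) (hJc : IsPreconnected J) (hα : ∀ t ∈ J, IsSolAt χ Y α t)
    (hβ : ∀ t ∈ J, IsSolAt χ Y β t) {t₀ : ℝ} (ht₀ : t₀ ∈ J) (h : α t₀ = β t₀) : EqOn α β J := by
  have hev : ∀ γ : ℝ → N, (∀ t ∈ J, IsSolAt χ Y γ t) → ∀ t ∈ J, ∀ᶠ s in 𝓝 t, IsSolAt χ Y γ s :=
    fun γ hγ t ht ↦ Filter.eventually_of_mem (hJ.mem_nhds ht) hγ
  have hsub : J ⊆ {t | α =ᶠ[𝓝 t] β} := by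
    refine hJc.subset_of_closure_inter_subset ?_
      ⟨t₀, ht₀, hY.eventuallyEq (hev α hα t₀ ht₀) (hev β hβ t₀ ht₀) h⟩ ?_
    · exact isOpen_iff_mem_nhds.2 fun t ht ↦ Filter.EventuallyEq.eventuallyEq_nhds ht
    · rintro t ⟨htc, ht⟩
      refine hY.eventuallyEq (hev α hα t ht) (hev β hβ t ht) ?_
      have hne : (𝓝[{t | α =ᶠ[𝓝 t] β}] t).NeBot := mem_closure_iff_nhdsWithin_neBot.1 htc
      refine tendsto_nhds_unique_of_eventuallyEq (l := 𝓝[{t | α =ᶠ[𝓝 t] β}] t)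
        ((hα t ht).1.tendsto.mono_left nhdsWithin_le_nhds)
        ((hβ t ht).1.tendsto.mono_left nhdsWithin_le_nhds) ?_
      filter_upwards [self_mem_nhdsWithin] with s hs
      exact Filter.EventuallyEq.eq_of_nhds hs
  exact fun t ht ↦ Filter.EventuallyEq.eq_of_nhds (hsub ht)

/-- `Φ n` is a global integral curve of `Y` starting at `n`. -/
structure IsGlobalFlow (χ : ι → OpenPartialHomeomorph N V) (Y : ι → V → V) (Φ : N → ℝ → N) :
    Prop where
  zero : ∀ n, Φ n 0 = n
  isSolAt : ∀ n t, IsSolAt χ Y (Φ n) t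

theorem IsGlobalFlow.add [T2Space N] (hY : IsVectorField χ Y) {Φ : N → ℝ → N}
    (hΦ : IsGlobalFlow χ Y Φ) (n : N) (s t : ℝ) : Φ n (t + s) = Φ (Φ n s) t := by
  have := hY.eqOn isOpen_univ isPreconnected_univ (α := fun t ↦ Φ n (t + s)) (β := Φ (Φ n s))
    (fun t _ ↦ (hΦ.isSolAt n (t + s)).comp_add) (fun t _ ↦ hΦ.isSolAt _ t) (mem_univ 0)
    (by simp [hΦ.zero])
  exact this (mem_univ t)

/-- Uniqueness of solutions identifies the abstract global flow with any local flow built in a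
chart, so that coordinate estimates apply to it. -/
theorem IsGlobalFlow.eq_symm [T2Space N] (hY : IsVectorField χ Y) {Φ : N → ℝ → N}
    (hΦ : IsGlobalFlow χ Y Φ) {i : ι} {σ : ℝ → V} {ε : ℝ}
    (hσ : ∀ t ∈ Ioo (-ε) ε, HasDerivAt σ (Y i (σ t)) t ∧ σ t ∈ (χ i).target)
    {n : N} (hn : n ∈ (χ i).source) (h0 : σ 0 = χ i n) {t : ℝ} (ht : t ∈ Ioo (-ε) ε) :
    Φ n t = (χ i).symm (σ t) := by
  have hε : 0 < ε := by linarith [ht.1, ht.2]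
  exact hY.eqOn isOpen_Ioo isPreconnected_Ioo (fun t _ ↦ hΦ.isSolAt n t)
    (fun t ht ↦ isSolAt_symm_comp (hσ t ht).1 (hσ t ht).2) (t₀ := 0) ⟨by linarith, hε⟩
    (by rw [hΦ.zero, h0, (χ i).left_inv hn]) ht

/-- The time `s` flow map is continuous at `n`, and it maps curves through `n` with velocity `X` to
curves with velocity `X`. -/
def PreservesAt (χ : ι → OpenPartialHomeomorph N V) (X : ι → V → V) (Φ : N → ℝ → N) (s : ℝ)
    (n : N) : Prop :=
  ContinuousAt (fun m ↦ Φ m s) n ∧ ∀ (β : ℝ → N) (t₀ : ℝ), β t₀ = n → IsSolAt χ X β t₀ →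
    IsSolAt χ X (fun t ↦ Φ (β t) s) t₀

/-- For short times the flow stays in one chart, where `hasDerivAt_localFlow` applies; the C²
regularity of `Y` supplies the Lipschitz bound on its derivative. -/
theorem preservesAt_local [CompleteSpace V] [T2Space N] (hY : IsVectorField χ Y)
    (hX : IsVectorField χ X)
    (hcomm : ∀ i, ∀ z ∈ (χ i).target, fderiv ℝ (Y i) z (X i z) = fderiv ℝ (X i) z (Y i z))
    {Φ : N → ℝ → N} (hΦ : IsGlobalFlow χ Y Φ) {i : ι} {n₀ : N} (hn₀ : n₀ ∈ (χ i).source) :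
    ∃ U ∈ 𝓝 n₀, ∃ ε > 0, ∀ n ∈ U, ∀ s ∈ Ioo (-ε) ε, PreservesAt χ X Φ s n := by
  set z₀ := χ i n₀
  have hz₀ : z₀ ∈ (χ i).target := (χ i).map_source hn₀
  have hYz := hY.contDiffAt hz₀
  have hXz := hX.contDiffAt hz₀
  obtain ⟨K, S₁, hS₁, hK⟩ := (hYz.of_le one_le_two).exists_lipschitzOnWith
  obtain ⟨L, S₂, hS₂, hL⟩ := (hYz.fderiv_right (m := 1) le_rfl).exists_lipschitzOnWith
  have hS₃ : ∀ᶠ z in 𝓝 z₀, ‖X i z‖ < ‖X i z₀‖ + 1 :=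
    (hXz.continuousAt.norm).eventually_lt_const (by linarith)
  -- All bounds hold on the ball of radius `R`, while the local flow is kept in the ball of radius
  -- `R / 2`, leaving room for the displaced approximate trajectory.
  obtain ⟨R, hR, hRS⟩ := Metric.mem_nhds_iff.1 (Filter.inter_mem (Filter.inter_mem hS₁ hS₂)
    (Filter.inter_mem ((χ i).open_target.mem_nhds hz₀) hS₃))
  obtain ⟨α, U, hUo, hzU, ε, hε, hαc, hα⟩ := exists_localFlow (hYz.of_le one_le_two)
    (Metric.ball_mem_nhds z₀ (half_pos hR))
  have hRt : Metric.ball z₀ R ⊆ (χ i).target := fun z hz ↦ (hRS hz).2.1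
  have hRR : Metric.ball z₀ (R / 2) ⊆ Metric.ball z₀ R := Metric.ball_subset_ball (by linarith)
  have hUn : ∀ n, n ∈ (χ i).source → χ i n ∈ U → (χ i).source ∩ χ i ⁻¹' U ∈ 𝓝 n := fun n h h' ↦
    Filter.inter_mem ((χ i).open_source.mem_nhds h)
      (((χ i).continuousAt h).preimage_mem_nhds (hUo.mem_nhds h'))
  refine ⟨(χ i).source ∩ χ i ⁻¹' U, hUn n₀ hn₀ hzU, ε, hε, fun n hn s hs ↦ ?_⟩
  have hΦα : ∀ m ∈ (χ i).source ∩ χ i ⁻¹' U, Φ m s = (χ i).symm (α (χ i m, s)) := fun m hm ↦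
    hΦ.eq_symm hY (fun t ht ↦ ⟨((hα _ hm.2).2 t ht).1, hRt (hRR ((hα _ hm.2).2 t ht).2)⟩) hm.1
      (hα _ hm.2).1 hs
  have htar : ∀ m ∈ (χ i).source ∩ χ i ⁻¹' U, α (χ i m, s) ∈ (χ i).target := fun m hm ↦
    hRt (hRR ((hα _ hm.2).2 s hs).2)
  have hcont : ContinuousAt (fun m ↦ Φ m s) n := by
    have h1 : ContinuousAt α (χ i n, s) :=
      hαc.continuousAt (prod_mem_nhds (hUo.mem_nhds hn.2) (Ioo_mem_nhds hs.1 hs.2))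
    have h2 : ContinuousAt (fun m ↦ α (χ i m, s)) n :=
      ContinuousAt.comp (f := fun m ↦ (χ i m, s)) h1
        (((χ i).continuousAt hn.1).prodMk continuousAt_const)
    have h3 : ContinuousAt (fun m ↦ (χ i).symm (α (χ i m, s))) n :=
      ContinuousAt.comp (f := fun m ↦ α (χ i m, s)) ((χ i).continuousAt_symm (htar n hn)) h2
    refine h3.congr ?_
    filter_upwards [hUn n hn.1 hn.2] with m hm using (hΦα m hm).symm
  refine ⟨hcont, fun β t₀ hβ hsol ↦ ?_⟩
  have hd := hX.hasDerivAt hsol (j := i) (by rw [hβ]; exact hn.1)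
  have hpush := hasDerivAt_localFlow (f := Y i) (g := X i) (z₀ := z₀) (R := R) (K := K) (L := L)
    (C := ‖X i z₀‖ + 1) (hK.mono fun z hz ↦ (hRS hz).1.1)
    (fun z hz ↦ (hY.contDiffAt (hRt hz)).differentiableAt two_ne_zero)
    (fun z hz w hw ↦ by
      simpa [dist_eq_norm] using hL.dist_le_mul z (hRS hz).1.2 w (hRS hw).1.2)
    L.2 (fun z hz ↦ (hX.contDiffAt (hRt hz)).differentiableAt two_ne_zero)
    (fun z hz ↦ (hRS hz).2.2.le) (fun z hz ↦ hcomm i z (hRt hz)) hUo hα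
    (a := χ i ∘ β) (t₀ := t₀) hd (by simpa [hβ] using hn.2) hs
  have hm : β t₀ ∈ (χ i).source ∩ χ i ⁻¹' U := by rwa [hβ]
  refine ⟨ContinuousAt.comp (g := fun m ↦ Φ m s) (f := β) (by rw [hβ]; exact hcont) hsol.1, i,
    ?_, ?_⟩
  · beta_reduce
    rw [hΦα _ hm]
    exact (χ i).map_target (htar _ hm)
  · beta_reduce
    rw [hΦα _ hm, (χ i).right_inv (htar _ hm)]
    refine hpush.congr_of_eventuallyEq ?_
    filter_upwards [hsol.1.preimage_mem_nhds (hUn _ hm.1 hm.2)] with t ht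
    simp only [Function.comp_apply]
    rw [hΦα _ ht, (χ i).right_inv (htar _ ht)]

/-- The flow of a complete vector field `Y` preserves every vector field `X` which commutes
with `Y`. -/
theorem preservesAt [CompleteSpace V] [T2Space N] (hχ : ∀ n, ∃ i, n ∈ (χ i).source)
    (hY : IsVectorField χ Y) (hX : IsVectorField χ X)
    (hcomm : ∀ i, ∀ z ∈ (χ i).target, fderiv ℝ (Y i) z (X i z) = fderiv ℝ (X i) z (Y i z))
    {Φ : N → ℝ → N} (hΦ : IsGlobalFlow χ Y Φ) (s : ℝ) (n : N) : PreservesAt χ X Φ s n := by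
  have hadd : ∀ s t, PreservesAt χ X Φ s n → PreservesAt χ X Φ t (Φ n s) →
      PreservesAt χ X Φ (t + s) n := by
    intro s t h1 h2
    have e : ∀ m, Φ m (t + s) = Φ (Φ m s) t := fun m ↦ hΦ.add hY m s t
    refine ⟨?_, fun β t₀ hβ hsol ↦ ?_⟩
    · simp only [e]
      exact ContinuousAt.comp (f := fun m ↦ Φ m s) h2.1 h1.1
    · simp only [e]
      exact h2.2 (fun t ↦ Φ (β t) s) t₀ (by rw [hβ]) (h1.2 β t₀ hβ hsol)
  -- The time `s` and time `s₀` maps differ by a short-time map near `Φ n s₀`, which preserves `X`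
  -- in both time directions. So the property is locally constant in the time, and connectedness of
  -- ℝ carries it from 0 to every `s`.
  have hloc : ∀ s₀, ∀ᶠ s in 𝓝 s₀, PreservesAt χ X Φ s n ↔ PreservesAt χ X Φ s₀ n := by
    intro s₀
    obtain ⟨i, hi⟩ := hχ (Φ n s₀)
    obtain ⟨U, hU, ε, hε, h⟩ := preservesAt_local hY hX hcomm hΦ hi
    filter_upwards [(hΦ.isSolAt n s₀).1.preimage_mem_nhds hU,
      Ioo_mem_nhds (sub_lt_self s₀ hε) (lt_add_of_pos_right s₀ hε)] with s hs hs'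
    constructor
    · intro h1
      have := hadd s (s₀ - s) h1 (h _ hs _ ⟨by linarith [hs'.2], by linarith [hs'.1]⟩)
      rwa [sub_add_cancel] at this
    · intro h1
      have := hadd s₀ (s - s₀) h1 (h _ (mem_of_mem_nhds hU) _
        ⟨by linarith [hs'.1], by linarith [hs'.2]⟩)
      rwa [sub_add_cancel] at this
  have hclopen : IsClopen {s | PreservesAt χ X Φ s n} := by
    refine ⟨⟨isOpen_iff_mem_nhds.2 fun s₀ hs₀ ↦ ?_⟩, isOpen_iff_mem_nhds.2 fun s₀ hs₀ ↦ ?_⟩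
    · filter_upwards [hloc s₀] with s hs using fun h ↦ hs₀ (hs.1 h)
    · filter_upwards [hloc s₀] with s hs using hs.2 hs₀
  have h0 : PreservesAt χ X Φ 0 n := by
    refine ⟨by simp only [hΦ.zero]; exact continuousAt_id, fun β t₀ _ hsol ↦ ?_⟩
    simpa only [hΦ.zero] using hsol
  exact (hclopen.eq_univ ⟨0, h0⟩ ▸ mem_univ s : s ∈ {s | PreservesAt χ X Φ s n})

theorem IsVectorField.exists_isSolAt_nhds [CompleteSpace V] (hY : IsVectorField χ Y) {i : ι} {n₀ : N}
    (hn₀ : n₀ ∈ (χ i).source) : ∃ ε > 0, ∀ᶠ n in 𝓝 n₀, ∃ α : ℝ → N, α 0 = n ∧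
      ∀ t ∈ Ioo (-ε) ε, IsSolAt χ Y α t := by
  have hz₀ := (χ i).map_source hn₀
  obtain ⟨α, U, hUo, hzU, ε, hε, -, hα⟩ := exists_localFlow
    ((hY.contDiffAt hz₀).of_le one_le_two) ((χ i).open_target.mem_nhds hz₀)
  refine ⟨ε, hε, ?_⟩
  filter_upwards [(χ i).open_source.mem_nhds hn₀,
    ((χ i).continuousAt hn₀).preimage_mem_nhds (hUo.mem_nhds hzU)] with n hn hnU
  refine ⟨fun t ↦ (χ i).symm (α (χ i n, t)), ?_, fun t ht ↦ ?_⟩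
  · beta_reduce
    rw [(hα _ hnU).1, (χ i).left_inv hn]
  · exact isSolAt_symm_comp ((hα _ hnU).2 t ht).1 ((hα _ hnU).2 t ht).2

end Atlas

/-! ### The geodesic spray and complete lifts in coordinates -/

section FlatGeometry

variable {E : Type*} [NormedAddCommGroup E] [NormedSpace ℝ E]

/-- `G` is a smooth strong (possibly indefinite) metric on the open set `Ω`. -/
structure IsStrongMetricOn (G : E → E →L[ℝ] E →L[ℝ] ℝ) (Ω : Set E) : Prop where
  isOpen : IsOpen Ω
  contDiffOn : ContDiffOn ℝ ∞ G Ω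
  symm : ∀ z ∈ Ω, ∀ u v, G z u v = G z v u
  isInvertible : ∀ z ∈ Ω, (G z).IsInvertible

/-- The geodesic spray in coordinates. -/
def spray (G : E → E →L[ℝ] E →L[ℝ] ℝ) (p : E × E) : E × E :=
  (p.2, -christoffel G p.1 p.2 p.2)

/-- The complete lift of a vector field to the tangent bundle, in coordinates. -/
def completeLift (f : E → E) (p : E × E) : E × E :=
  (f p.1, fderiv ℝ f p.1 p.2)

namespace IsStrongMetricOn

variable {G : E → E →L[ℝ] E →L[ℝ] ℝ} {Ω : Set E} {z : E}

theorem contDiffAt (hG : IsStrongMetricOn G Ω) (hz : z ∈ Ω) : ContDiffAt ℝ ∞ G z :=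
  hG.contDiffOn.contDiffAt (hG.isOpen.mem_nhds hz)

theorem differentiableAt (hG : IsStrongMetricOn G Ω) (hz : z ∈ Ω) : DifferentiableAt ℝ G z :=
  (hG.contDiffAt hz).differentiableAt (by simp)

theorem christoffel_spec (hG : IsStrongMetricOn G Ω) (hz : z ∈ Ω) (u v w : E) :
    G z (christoffel G z u v) w =
      1 / 2 * (fderiv ℝ G z u v w + fderiv ℝ G z v u w - fderiv ℝ G z w u v) := by
  rw [christoffel_apply, (hG.isInvertible z hz).self_apply_inverse, christoffelFirst_apply]

theorem ext (hG : IsStrongMetricOn G Ω) (hz : z ∈ Ω) {a b : E} (h : ∀ w, G z a w = G z b w) :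
    a = b :=
  (hG.isInvertible z hz).injective (ContinuousLinearMap.ext h)

theorem fderiv_symm (hG : IsStrongMetricOn G Ω) (hz : z ∈ Ω) (a u v : E) :
    fderiv ℝ G z a u v = fderiv ℝ G z a v u := by
  have h1 : (fun y ↦ G y u v) =ᶠ[𝓝 z] fun y ↦ G y v u := by
    filter_upwards [hG.isOpen.mem_nhds hz] with y hy using hG.symm y hy u v
  have h2 : ∀ u v, fderiv ℝ (fun y ↦ G y u v) z a = fderiv ℝ G z a u v := fun u v ↦ by
    have := (((hG.differentiableAt hz).hasFDerivAt.clm_apply (hasFDerivAt_const u z)).clm_apply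
      (hasFDerivAt_const v z)).fderiv
    rw [this]; simp
  rw [← h2, ← h2, h1.fderiv_eq]

set_option synthInstance.maxHeartbeats 200000 in
theorem contDiffOn_christoffel [CompleteSpace E] (hG : IsStrongMetricOn G Ω) :
    ContDiffOn ℝ ∞ (christoffel G) Ω := by
  intro z hz
  refine ContDiffAt.contDiffWithinAt ?_
  have hG1 := hG.contDiffAt hz
  have hD : ContDiffAt ℝ ∞ (fderiv ℝ G) z := hG1.fderiv_right (by simp)
  have hinv : ContDiffAt ℝ ∞ (fun y ↦ (G y).inverse) z :=
    (hG.isInvertible z hz).contDiffAt_map_inverse.comp z hG1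
  have hflip : ContDiffAt ℝ ∞ (fun y ↦ (fderiv ℝ G y).flip) z :=
    ((ContinuousLinearMap.flipₗᵢ ℝ E E
      (E →L[ℝ] ℝ)).toContinuousLinearEquiv.contDiff.contDiffAt).comp z hD
  have hfirst : ContDiffAt ℝ ∞ (christoffelFirst G) z := by
    unfold christoffelFirst
    exact ContDiffAt.const_smul (1 / 2 : ℝ) ((hD.add hflip).sub (contDiffAt_const.clm_comp hflip))
  unfold christoffel
  exact (((ContinuousLinearMap.compL ℝ E (E →L[ℝ] ℝ) E).contDiff.contDiffAt).comp z
    hinv).clm_comp hfirst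

theorem contDiffOn_spray [CompleteSpace E] (hG : IsStrongMetricOn G Ω) :
    ContDiffOn ℝ ∞ (spray G) (Ω ×ˢ univ) := by
  have h1 : ContDiffOn ℝ ∞ (fun p : E × E ↦ christoffel G p.1) (Ω ×ˢ univ) :=
    hG.contDiffOn_christoffel.comp contDiffOn_fst fun p hp ↦ hp.1
  exact contDiffOn_snd.prodMk ((h1.clm_apply contDiffOn_snd).clm_apply contDiffOn_snd).neg

end IsStrongMetricOn

theorem contDiffOn_completeLift {f : E → E} {Ω : Set E} (hΩ : IsOpen Ω)
    (hf : ContDiffOn ℝ ∞ f Ω) : ContDiffOn ℝ ∞ (completeLift f) (Ω ×ˢ univ) := by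
  have h1 : ContDiffOn ℝ ∞ (fun p : E × E ↦ fderiv ℝ f p.1) (Ω ×ˢ univ) :=
    (hf.fderiv_of_isOpen hΩ (m := ∞) (by simp)).comp contDiffOn_fst fun p hp ↦ hp.1
  exact (hf.comp contDiffOn_fst fun p hp ↦ hp.1).prodMk (h1.clm_apply contDiffOn_snd)

theorem isSymmSndFDerivAt_of_contDiffAt_infty {F : Type*} [NormedAddCommGroup F] [NormedSpace ℝ F]
    {f : E → F} {z : E} (hf : ContDiffAt ℝ ∞ f z) : IsSymmSndFDerivAt ℝ f z :=
  hf.isSymmSndFDerivAt (by simp only [minSmoothness_of_isRCLikeNormedField]; exact WithTop.coe_le_coe.2 le_top)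

/-! ### Change of coordinates -/

section Transition

variable {φ : E → E} {z : E}

/-- The transition map of the tangent bundle. -/
def tangentTransition (φ : E → E) (p : E × E) : E × E :=
  (φ p.1, fderiv ℝ φ p.1 p.2)

theorem hasFDerivAt_tangentTransition (hφ : ContDiffAt ℝ ∞ φ z) (u : E) :
    HasFDerivAt (tangentTransition φ)
      (((fderiv ℝ φ z).comp (ContinuousLinearMap.fst ℝ E E)).prod
        ((fderiv ℝ φ z).comp (ContinuousLinearMap.snd ℝ E E) +
          ((fderiv ℝ (fderiv ℝ φ) z).comp (ContinuousLinearMap.fst ℝ E E)).flip u)) (z, u) := by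
  have h1 : HasFDerivAt φ (fderiv ℝ φ z) ((z, u) : E × E).1 :=
    (hφ.differentiableAt (by simp)).hasFDerivAt
  have h2 : HasFDerivAt (fderiv ℝ φ) (fderiv ℝ (fderiv ℝ φ) z) ((z, u) : E × E).1 :=
    ((hφ.fderiv_right (m := ∞) (by simp)).differentiableAt (by simp)).hasFDerivAt
  have h3 : HasFDerivAt (fun p : E × E ↦ φ p.1) _ (z, u) := h1.comp (z, u) hasFDerivAt_fst
  have h4 : HasFDerivAt (fun p : E × E ↦ fderiv ℝ φ p.1) _ (z, u) :=
    h2.comp (z, u) hasFDerivAt_fst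
  exact h3.prodMk (h4.clm_apply hasFDerivAt_snd)

/-- Differentiating the transformation law `h` of the field gives that of its complete lift, once
the second derivative of φ is known to be symmetric. -/
theorem completeLift_tangentTransition {f f' : E → E} (hφ : ContDiffAt ℝ ∞ φ z)
    (hf : DifferentiableAt ℝ f z) (hf' : DifferentiableAt ℝ f' (φ z))
    (h : ∀ᶠ y in 𝓝 z, f' (φ y) = fderiv ℝ φ y (f y)) (u : E) :
    fderiv ℝ (tangentTransition φ) (z, u) (completeLift f (z, u)) =
      completeLift f' (tangentTransition φ (z, u)) := by
  have h1 : HasFDerivAt φ (fderiv ℝ φ z) z := (hφ.differentiableAt (by simp)).hasFDerivAt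
  have h2 : HasFDerivAt (fderiv ℝ φ) (fderiv ℝ (fderiv ℝ φ) z) z :=
    ((hφ.fderiv_right (m := ∞) (by simp)).differentiableAt (by simp)).hasFDerivAt
  have h3 := (hf'.hasFDerivAt.comp z h1).fderiv
  have h4 := (h2.clm_apply hf.hasFDerivAt).fderiv
  have h5 : f' ∘ φ =ᶠ[𝓝 z] fun y ↦ fderiv ℝ φ y (f y) := h
  rw [h5.fderiv_eq, h4] at h3
  have h6 := congrArg (fun L ↦ L u) h3
  have hs := isSymmSndFDerivAt_of_contDiffAt_infty hφ (f z) u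
  simp only [add_apply, ContinuousLinearMap.comp_apply,
    ContinuousLinearMap.flip_apply] at h6
  rw [(hasFDerivAt_tangentTransition hφ u).fderiv]
  ext1
  · simp [completeLift, tangentTransition, h.self_of_nhds]
  · simp only [completeLift, tangentTransition, ContinuousLinearMap.prod_apply,
      add_apply, ContinuousLinearMap.comp_apply,
      ContinuousLinearMap.flip_apply, ContinuousLinearMap.coe_fst', ContinuousLinearMap.coe_snd']
    rw [← h6, hs]

variable {G G' : E → E →L[ℝ] E →L[ℝ] ℝ} {Ω Ω' : Set E}

theorem fderiv_metric_transition (hG : IsStrongMetricOn G Ω) (hG' : IsStrongMetricOn G' Ω')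
    (hφ : ContDiffAt ℝ ∞ φ z) (hz : z ∈ Ω) (hz' : φ z ∈ Ω')
    (h : ∀ᶠ y in 𝓝 z, ∀ u v, G y u v = G' (φ y) (fderiv ℝ φ y u) (fderiv ℝ φ y v)) (a u v : E) :
    fderiv ℝ G z a u v =
      fderiv ℝ G' (φ z) (fderiv ℝ φ z a) (fderiv ℝ φ z u) (fderiv ℝ φ z v) +
      G' (φ z) (fderiv ℝ (fderiv ℝ φ) z a u) (fderiv ℝ φ z v) +
      G' (φ z) (fderiv ℝ φ z u) (fderiv ℝ (fderiv ℝ φ) z a v) := by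
  have h1 : HasFDerivAt φ (fderiv ℝ φ z) z := (hφ.differentiableAt (by simp)).hasFDerivAt
  have h2 : HasFDerivAt (fderiv ℝ φ) (fderiv ℝ (fderiv ℝ φ) z) z :=
    ((hφ.fderiv_right (m := ∞) (by simp)).differentiableAt (by simp)).hasFDerivAt
  have hu := h2.clm_apply (hasFDerivAt_const u z)
  have hv := h2.clm_apply (hasFDerivAt_const v z)
  have h3 := (hG'.differentiableAt hz').hasFDerivAt.comp z h1
  have h4 := ((h3.clm_apply hu).clm_apply hv).fderiv
  have h5 := (((hG.differentiableAt hz).hasFDerivAt.clm_apply (hasFDerivAt_const u z)).clm_apply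
      (hasFDerivAt_const v z)).fderiv
  have h6 : (fun y ↦ G y u v) =ᶠ[𝓝 z]
      fun y ↦ (G' ∘ φ) y (fderiv ℝ φ y u) (fderiv ℝ φ y v) := by
    filter_upwards [h] with y hy using hy u v
  rw [h6.fderiv_eq, h4] at h5
  have h7 := congrArg (fun L ↦ L a) h5
  simp at h7
  rw [← h7]
  ring

/-- The inhomogeneous second-derivative term in the transformation law of the Christoffel symbols is
exactly the one produced by the tangent transition map. The law `key` follows from Koszul's formula;
surjectivity makes the vectors Dφ(w) enough to test against. -/
theorem spray_tangentTransition (hG : IsStrongMetricOn G Ω) (hG' : IsStrongMetricOn G' Ω')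
    (hφ : ContDiffAt ℝ ∞ φ z) (hz : z ∈ Ω) (hz' : φ z ∈ Ω')
    (hsurj : Function.Surjective (fderiv ℝ φ z))
    (h : ∀ᶠ y in 𝓝 z, ∀ u v, G y u v = G' (φ y) (fderiv ℝ φ y u) (fderiv ℝ φ y v)) (u : E) :
    fderiv ℝ (tangentTransition φ) (z, u) (spray G (z, u)) =
      spray G' (tangentTransition φ (z, u)) := by
  have key : fderiv ℝ φ z (christoffel G z u u) =
      christoffel G' (φ z) (fderiv ℝ φ z u) (fderiv ℝ φ z u) + fderiv ℝ (fderiv ℝ φ) z u u := by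
    refine hG'.ext hz' fun w' ↦ ?_
    obtain ⟨w, rfl⟩ := hsurj w'
    rw [← h.self_of_nhds, hG.christoffel_spec hz, map_add, add_apply,
      hG'.christoffel_spec hz', fderiv_metric_transition hG hG' hφ hz hz' h,
      fderiv_metric_transition hG hG' hφ hz hz' h,
      isSymmSndFDerivAt_of_contDiffAt_infty hφ w u,
      hG'.symm _ hz' (fderiv ℝ (fderiv ℝ φ) z u w)]
    ring
  rw [(hasFDerivAt_tangentTransition hφ u).fderiv]
  ext1
  · simp [spray, tangentTransition]
  · simp [spray, tangentTransition, key]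

/-- The Lie derivative of a metric along a vector field. -/
def lieDerivMetric (G : E → E →L[ℝ] E →L[ℝ] ℝ) (f : E → E) (z a b : E) : ℝ :=
  fderiv ℝ G z (f z) a b + G z (fderiv ℝ f z a) b + G z a (fderiv ℝ f z b)

/-- The second-derivative terms from the metric and from the field cancel. This moves the Killing
equation from the centre of a chart, where `leviCivita` is computed, to every other chart. -/
theorem lieDerivMetric_transition (hG : IsStrongMetricOn G Ω) (hG' : IsStrongMetricOn G' Ω')
    (hφ : ContDiffAt ℝ ∞ φ z) (hz : z ∈ Ω) (hz' : φ z ∈ Ω')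
    (h : ∀ᶠ y in 𝓝 z, ∀ u v, G y u v = G' (φ y) (fderiv ℝ φ y u) (fderiv ℝ φ y v))
    {f f' : E → E} (hf : DifferentiableAt ℝ f z) (hf' : DifferentiableAt ℝ f' (φ z))
    (hff : ∀ᶠ y in 𝓝 z, f' (φ y) = fderiv ℝ φ y (f y)) (a b : E) :
    lieDerivMetric G f z a b =
      lieDerivMetric G' f' (φ z) (fderiv ℝ φ z a) (fderiv ℝ φ z b) := by
  have h1 : ∀ u, fderiv ℝ f' (φ z) (fderiv ℝ φ z u) =
      fderiv ℝ (fderiv ℝ φ) z (f z) u + fderiv ℝ φ z (fderiv ℝ f z u) := fun u ↦ by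
    have := congrArg Prod.snd (completeLift_tangentTransition hφ hf hf' hff u)
    rw [(hasFDerivAt_tangentTransition hφ u).fderiv] at this
    simp only [completeLift, tangentTransition, ContinuousLinearMap.prod_apply,
      add_apply, ContinuousLinearMap.comp_apply,
      ContinuousLinearMap.flip_apply, ContinuousLinearMap.coe_fst',
      ContinuousLinearMap.coe_snd'] at this
    rw [← this, add_comm]
  simp only [lieDerivMetric]
  rw [fderiv_metric_transition hG hG' hφ hz hz' h, h1, h1, hff.self_of_nhds, h.self_of_nhds,
    h.self_of_nhds]
  simp only [map_add, add_apply]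
  ring

end Transition

/-! ### The complete lift of a Killing field commutes with the geodesic spray -/

section Killing

variable {G : E → E →L[ℝ] E →L[ℝ] ℝ} {Ω : Set E} {f : E → E} {z : E}

theorem fderiv_lieDerivMetric_eq_zero (hG : IsStrongMetricOn G Ω) (hf : ContDiffOn ℝ ∞ f Ω)
    (hK : ∀ y ∈ Ω, ∀ a b, lieDerivMetric G f y a b = 0) (hz : z ∈ Ω) (e a b : E) :
    fderiv ℝ (fderiv ℝ G) z e (f z) a b + fderiv ℝ G z (fderiv ℝ f z e) a b +
      (fderiv ℝ G z e (fderiv ℝ f z a) b + G z (fderiv ℝ (fderiv ℝ f) z e a) b) +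
      (fderiv ℝ G z e a (fderiv ℝ f z b) + G z a (fderiv ℝ (fderiv ℝ f) z e b)) = 0 := by
  have hfz := hf.contDiffAt (hG.isOpen.mem_nhds hz)
  have hGd := (hG.differentiableAt hz).hasFDerivAt
  have hfd := (hfz.differentiableAt (by simp)).hasFDerivAt
  have hG2 := (((hG.contDiffAt hz).fderiv_right (m := ∞) (by simp)).differentiableAt
    (by simp)).hasFDerivAt
  have hf2 := ((hfz.fderiv_right (m := ∞) (by simp)).differentiableAt (by simp)).hasFDerivAt
  have hca := hasFDerivAt_const (𝕜 := ℝ) a z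
  have hcb := hasFDerivAt_const (𝕜 := ℝ) b z
  have h1 := ((hG2.clm_apply hfd).clm_apply hca).clm_apply hcb
  have h2 := (hGd.clm_apply (hf2.clm_apply hca)).clm_apply hcb
  have h3 := (hGd.clm_apply hca).clm_apply (hf2.clm_apply hcb)
  have h4 := ((h1.add h2).add h3).fderiv
  have h5 : (fun y ↦ lieDerivMetric G f y a b) =ᶠ[𝓝 z] fun _ ↦ 0 := by
    filter_upwards [hG.isOpen.mem_nhds hz] with y hy using hK y hy a b
  have h6 := h5.fderiv_eq (𝕜 := ℝ)
  have h7 : fderiv ℝ (fun y ↦ lieDerivMetric G f y a b) z = _ := h4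
  rw [h6] at h7
  have h8 := congrArg (fun L ↦ L e) h7
  simp at h8
  linarith

theorem fderiv_christoffel_spec [CompleteSpace E] (hG : IsStrongMetricOn G Ω) (hz : z ∈ Ω)
    (e u w : E) :
    fderiv ℝ G z e (christoffel G z u u) w + G z (fderiv ℝ (christoffel G) z e u u) w =
      fderiv ℝ (fderiv ℝ G) z e u u w - 1 / 2 * fderiv ℝ (fderiv ℝ G) z e w u u := by
  have hGd := (hG.differentiableAt hz).hasFDerivAt
  have hΓ := ((hG.contDiffOn_christoffel.contDiffAt (hG.isOpen.mem_nhds hz)).differentiableAt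
    (by simp)).hasFDerivAt
  have hG2 := (((hG.contDiffAt hz).fderiv_right (m := ∞) (by simp)).differentiableAt
    (by simp)).hasFDerivAt
  have hcu := hasFDerivAt_const (𝕜 := ℝ) u z
  have hcw := hasFDerivAt_const (𝕜 := ℝ) w z
  have h1 := ((hGd.clm_apply ((hΓ.clm_apply hcu).clm_apply hcu)).clm_apply hcw).fderiv
  have h2 := ((((hG2.clm_apply hcu).clm_apply hcu).clm_apply hcw).sub
    ((((hG2.clm_apply hcw).clm_apply hcu).clm_apply hcu).const_mul (1 / 2))).fderiv
  have h3 : (fun y ↦ G y (christoffel G y u u) w) =ᶠ[𝓝 z]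
      fun y ↦ fderiv ℝ G y u u w - 1 / 2 * fderiv ℝ G y w u u := by
    filter_upwards [hG.isOpen.mem_nhds hz] with y hy
    rw [hG.christoffel_spec hy]; ring
  have h4 := h3.fderiv_eq (𝕜 := ℝ)
  have h5 : fderiv ℝ (fun y ↦ fderiv ℝ G y u u w - 1 / 2 * fderiv ℝ G y w u u) z = _ := h2
  rw [h1, h5] at h4
  have h6 := congrArg (fun L ↦ L e) h4
  simp at h6
  linarith

/-- A field that preserves the metric preserves its Levi-Civita connection: the derivative of
Koszul's formula along `f` is combined with the first derivatives of the equation L_f G = 0, and `G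
z` is nondegenerate. -/
theorem lieDeriv_christoffel_eq_zero [CompleteSpace E] (hG : IsStrongMetricOn G Ω)
    (hf : ContDiffOn ℝ ∞ f Ω) (hK : ∀ y ∈ Ω, ∀ a b, lieDerivMetric G f y a b = 0) (hz : z ∈ Ω)
    (u : E) :
    fderiv ℝ (christoffel G) z (f z) u u + christoffel G z (fderiv ℝ f z u) u +
      christoffel G z u (fderiv ℝ f z u) + fderiv ℝ (fderiv ℝ f) z u u =
      fderiv ℝ f z (christoffel G z u u) := by
  refine hG.ext hz fun w ↦ ?_
  have k1 := fderiv_lieDerivMetric_eq_zero hG hf hK hz u u w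
  have k2 := fderiv_lieDerivMetric_eq_zero hG hf hK hz w u u
  have k3 := fderiv_christoffel_spec hG hz (f z) u w
  have k4 := hK z hz (christoffel G z u u) w
  have k5 := hG.christoffel_spec hz u u (fderiv ℝ f z w)
  have k6 := hG.christoffel_spec hz u (fderiv ℝ f z u) w
  have k7 := hG.christoffel_spec hz (fderiv ℝ f z u) u w
  -- Symmetry of `G` and of second derivatives brings equal terms to the same form; what remains is
  -- a linear combination of the identities above, with `k1` minus half of `k2` carrying the
  -- derivative of the Killing equation.
  have sG := isSymmSndFDerivAt_of_contDiffAt_infty (hG.contDiffAt hz)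
  have sf := isSymmSndFDerivAt_of_contDiffAt_infty (hf.contDiffAt (hG.isOpen.mem_nhds hz))
  rw [sG u (f z)] at k1
  rw [sG w (f z), sf w u, hG.symm z hz (fderiv ℝ (fderiv ℝ f) z u w) u,
    hG.fderiv_symm hz w (fderiv ℝ f z u) u] at k2
  rw [hG.fderiv_symm hz w (fderiv ℝ f z u) u] at k7
  simp only [lieDerivMetric] at k4
  simp only [map_add, add_apply]
  linarith

/-- The Lie bracket of spray and complete lift has trivial first component; its second component is
the Lie derivative of the Christoffel symbols at (u, u). -/
theorem fderiv_spray_completeLift [CompleteSpace E] (hG : IsStrongMetricOn G Ω)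
    (hf : ContDiffOn ℝ ∞ f Ω) (hK : ∀ y ∈ Ω, ∀ a b, lieDerivMetric G f y a b = 0) (hz : z ∈ Ω)
    (u : E) :
    fderiv ℝ (spray G) (z, u) (completeLift f (z, u)) =
      fderiv ℝ (completeLift f) (z, u) (spray G (z, u)) := by
  have hfz := hf.contDiffAt (hG.isOpen.mem_nhds hz)
  have hΓ : HasFDerivAt (christoffel G) _ ((z, u) : E × E).1 :=
    ((hG.contDiffOn_christoffel.contDiffAt (hG.isOpen.mem_nhds hz)).differentiableAt
    (by simp)).hasFDerivAt
  have h1 : HasFDerivAt (fun p : E × E ↦ christoffel G p.1) _ (z, u) :=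
    hΓ.comp (z, u) hasFDerivAt_fst
  have h2 := (hasFDerivAt_snd (𝕜 := ℝ) (p := (z, u))).prodMk
    ((h1.clm_apply hasFDerivAt_snd).clm_apply hasFDerivAt_snd).neg
  have h3 : fderiv ℝ (spray G) (z, u) = _ := h2.fderiv
  have h4 : fderiv ℝ (completeLift f) (z, u) = _ := (hasFDerivAt_tangentTransition hfz u).fderiv
  have key := lieDeriv_christoffel_eq_zero hG hf hK hz u
  rw [h3, h4]
  ext1
  · simp [spray, completeLift]
  · simp [spray, completeLift]
    rw [← key]
    abel

end Killing

end FlatGeometry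

/-! ### Charts of the tangent bundle, and the complete lift of a field on a manifold -/

section Charts

variable {E : Type*} [NormedAddCommGroup E]
  {M : Type*} [TopologicalSpace M] [ChartedSpace E M]

/-- The transition map between two preferred charts. -/
def transition (c d : M) : E → E :=
  chartAt E d ∘ (chartAt E c).symm

theorem transition_apply {c d x : M} (hc : x ∈ (chartAt E c).source) :
    transition c d (chartAt E c x) = chartAt E d x := by
  simp [transition, hc]

theorem eventually_chartAt_symm_mem {c d x : M} (hc : x ∈ (chartAt E c).source)
    (hd : x ∈ (chartAt E d).source) : ∀ᶠ z in 𝓝 (chartAt E c x),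
      ∃ y ∈ (chartAt E c).source, y ∈ (chartAt E d).source ∧ chartAt E c y = z := by
  filter_upwards [(chartAt E c).open_target.mem_nhds ((chartAt E c).map_source hc),
    ((chartAt E c).continuousAt_symm ((chartAt E c).map_source hc)).preimage_mem_nhds
      (by rw [(chartAt E c).left_inv hc]; exact (chartAt E d).open_source.mem_nhds hd)]
    with z hz hz'
  exact ⟨_, (chartAt E c).map_target hz, hz', (chartAt E c).right_inv hz⟩

variable [NormedSpace ℝ E] [IsManifold 𝓘(ℝ, E) ∞ M]

theorem toCoord_apply {c x : M} (hx : x ∈ (chartAt E c).source) (v : TangentSpace 𝓘(ℝ, E) x) :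
    toCoord c x v = tangentCoordChange 𝓘(ℝ, E) x c x v :=
  DFunLike.congr_fun (TangentBundle.continuousLinearMapAt_trivializationAt_eq_core hx) v

theorem ofCoord_apply {c x : M} (hx : x ∈ (chartAt E c).source) (u : E) :
    ofCoord c x u = tangentCoordChange 𝓘(ℝ, E) c x x u :=
  DFunLike.congr_fun (TangentBundle.symmL_trivializationAt_eq_core hx) u

theorem toCoord_ofCoord_of_mem {c x : M} (hx : x ∈ (chartAt E c).source) (u : E) :
    toCoord c x (ofCoord c x u) = u :=
  (trivializationAt E (TangentSpace 𝓘(ℝ, E)) c).continuousLinearMapAt_symmL hx u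

theorem ofCoord_toCoord_of_mem {c x : M} (hx : x ∈ (chartAt E c).source)
    (v : TangentSpace 𝓘(ℝ, E) x) : ofCoord c x (toCoord c x v) = v :=
  (trivializationAt E (TangentSpace 𝓘(ℝ, E)) c).symmL_continuousLinearMapAt hx v

theorem contDiffAt_transition {c d x : M} (hc : x ∈ (chartAt E c).source)
    (hd : x ∈ (chartAt E d).source) : ContDiffAt ℝ ∞ (transition c d) (chartAt E c x) := by
  have := contDiffWithinAt_ext_coord_change (I := 𝓘(ℝ, E)) (n := ∞) (x := d) (x' := c)
    (y := chartAt E c x) (by simp [hc, hd])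
  simpa [contDiffWithinAt_univ, transition] using this

theorem fderiv_transition {c d x : M} (hc : x ∈ (chartAt E c).source)
    (hd : x ∈ (chartAt E d).source) (u : E) :
    fderiv ℝ (transition c d) (chartAt E c x) u = toCoord d x (ofCoord c x u) := by
  have h := hasFDerivWithinAt_tangentCoordChange (I := 𝓘(ℝ, E)) (x := c) (y := d) (z := x)
    ⟨by simpa using hc, by simpa using hd⟩
  simp only [modelWithCornersSelf_coe, range_id, hasFDerivWithinAt_univ] at h
  have h' : fderiv ℝ (transition c d) (chartAt E c x) = tangentCoordChange 𝓘(ℝ, E) c d x := h.fderiv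
  rw [h', toCoord_apply hd]
  have h2 := tangentCoordChange_comp (I := 𝓘(ℝ, E)) (w := c) (x := x) (y := d) (z := x) (v := u)
    (by simp [hc, hd])
  have h3 := ofCoord_apply hc u
  exact (h2.symm.trans (congrArg (tangentCoordChange 𝓘(ℝ, E) x d x) h3.symm))

/-- The chart of the tangent bundle induced by the preferred chart at `c`. -/
def tbChart (c : M) : OpenPartialHomeomorph (TangentBundle 𝓘(ℝ, E) M) (E × E) :=
  (trivializationAt E (TangentSpace 𝓘(ℝ, E)) c).toOpenPartialHomeomorph ≫ₕ
    (chartAt E c).prod (OpenPartialHomeomorph.refl E)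

theorem mem_tbChart_source {c : M} {ξ : TangentBundle 𝓘(ℝ, E) M} :
    ξ ∈ (tbChart c).source ↔ ξ.proj ∈ (chartAt E c).source := by
  simp [tbChart]

theorem mem_tbChart_target {c : M} {p : E × E} :
    p ∈ (tbChart (M := M) c).target ↔ p.1 ∈ (chartAt E c).target := by
  simp +contextual [tbChart]

theorem tbChart_target (c : M) :
    (tbChart (M := M) c).target = (chartAt E c).target ×ˢ (univ : Set E) := by
  ext p
  rw [mem_tbChart_target]
  simp

theorem tbChart_apply {c : M} {ξ : TangentBundle 𝓘(ℝ, E) M} (h : ξ.proj ∈ (chartAt E c).source) :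
    tbChart c ξ = (chartAt E c ξ.proj, toCoord c ξ.proj ξ.2) := by
  refine Prod.ext rfl ?_
  exact ((trivializationAt E (TangentSpace 𝓘(ℝ, E)) c).continuousLinearMapAt_apply_of_mem ℝ h
    ξ.2).symm

theorem tbChart_symm_apply {c : M} {p : E × E} (h : p.1 ∈ (chartAt E c).target) :
    (tbChart (M := M) c).symm p = ⟨(chartAt E c).symm p.1, ofCoord c _ p.2⟩ := by
  have hx := (chartAt E c).map_target h
  refine (tbChart c).injOn ((tbChart c).map_target (mem_tbChart_target.2 h))
    (mem_tbChart_source.2 hx) ?_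
  rw [(tbChart c).right_inv (mem_tbChart_target.2 h), tbChart_apply hx]
  simp only [(chartAt E c).right_inv h, toCoord_ofCoord_of_mem hx]

theorem tbChart_comp_symm_eventuallyEq {c d : M} {ξ : TangentBundle 𝓘(ℝ, E) M}
    (hc : ξ ∈ (tbChart c).source) (hd : ξ ∈ (tbChart d).source) :
    tbChart d ∘ (tbChart c).symm =ᶠ[𝓝 (tbChart c ξ)] tangentTransition (transition c d) := by
  have h1 : (tbChart c).symm ⁻¹' (tbChart d).source ∈ 𝓝 (tbChart c ξ) :=
    ((tbChart c).continuousAt_symm ((tbChart c).map_source hc)).preimage_mem_nhds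
      (by rw [(tbChart c).left_inv hc]; exact (tbChart d).open_source.mem_nhds hd)
  filter_upwards [h1, (tbChart c).open_target.mem_nhds ((tbChart c).map_source hc)] with p hp hp'
  rw [mem_tbChart_target] at hp'
  rw [mem_preimage, tbChart_symm_apply hp', mem_tbChart_source] at hp
  have hx := (chartAt E c).map_target hp'
  simp only [Function.comp_apply, tangentTransition]
  rw [tbChart_symm_apply hp', tbChart_apply hp]
  refine Prod.ext rfl ?_
  have := fderiv_transition hx hp p.2
  rw [(chartAt E c).right_inv hp'] at this
  exact this.symm

/-- Needed for uniqueness of integral curves in the tangent bundle, hence for the group law of the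
geodesic flow. -/
instance [T2Space M] : T2Space (TangentBundle 𝓘(ℝ, E) M) := by
  refine ⟨fun ξ η hne ↦ ?_⟩
  have hcont : Continuous (TotalSpace.proj : TangentBundle 𝓘(ℝ, E) M → M) :=
    FiberBundle.continuous_proj E (TangentSpace 𝓘(ℝ, E))
  by_cases h : ξ.proj = η.proj
  · have h1 : ξ ∈ (tbChart ξ.proj).source := mem_tbChart_source.2 (mem_chart_source E _)
    have h2 : η ∈ (tbChart ξ.proj).source :=
      mem_tbChart_source.2 (h ▸ mem_chart_source E _)
    obtain ⟨u, v, hu, hv, hxu, hyv, huv⟩ :=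
      t2_separation (fun h ↦ hne ((tbChart ξ.proj).injOn h1 h2 h))
    refine ⟨_, _, (tbChart ξ.proj).isOpen_inter_preimage hu,
      (tbChart ξ.proj).isOpen_inter_preimage hv, ⟨h1, hxu⟩, ⟨h2, hyv⟩, ?_⟩
    exact (huv.preimage (tbChart ξ.proj)).mono inter_subset_right inter_subset_right
  · obtain ⟨u, v, hu, hv, hxu, hyv, huv⟩ := t2_separation h
    exact ⟨_, _, hu.preimage hcont, hv.preimage hcont, hxu, hyv, huv.preimage _⟩

/-- The coordinate expression of a vector field in the preferred chart at `c`. -/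
def fieldInChart (F : ∀ x : M, TangentSpace 𝓘(ℝ, E) x) (c : M) (z : E) : E :=
  toCoord c ((chartAt E c).symm z) (F ((chartAt E c).symm z))

theorem fieldInChart_apply (F : ∀ x : M, TangentSpace 𝓘(ℝ, E) x) {c x : M}
    (hx : x ∈ (chartAt E c).source) :
    fieldInChart F c (chartAt E c x) = toCoord c x (F x) := by
  rw [fieldInChart, (chartAt E c).left_inv hx]

theorem eventually_fieldInChart_transition (F : ∀ x : M, TangentSpace 𝓘(ℝ, E) x) {c d x : M}
    (hc : x ∈ (chartAt E c).source) (hd : x ∈ (chartAt E d).source) :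
    ∀ᶠ z in 𝓝 (chartAt E c x), fieldInChart F d (transition c d z) =
      fderiv ℝ (transition c d) z (fieldInChart F c z) := by
  filter_upwards [eventually_chartAt_symm_mem hc hd] with z hz
  obtain ⟨y, hyc, hyd, rfl⟩ := hz
  rw [transition_apply hyc, fieldInChart_apply F hyd, fderiv_transition hyc hyd,
    fieldInChart_apply F hyc, ofCoord_toCoord_of_mem hyc]

theorem contDiffOn_fieldInChart {F : ∀ x : M, TangentSpace 𝓘(ℝ, E) x}
    (hF : ContMDiff 𝓘(ℝ, E) 𝓘(ℝ, E).tangent ∞ (fun x ↦ (⟨x, F x⟩ : TangentBundle 𝓘(ℝ, E) M)))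
    (c : M) : ContDiffOn ℝ ∞ (fieldInChart F c) (chartAt E c).target := by
  intro z hz
  have hx := (chartAt E c).map_target hz
  have h1 := ((trivializationAt E (TangentSpace 𝓘(ℝ, E)) c).contMDiffAt_section_iff hx).1
    hF.contMDiffAt
  have h2 : ContMDiffAt 𝓘(ℝ, E) 𝓘(ℝ, E) ∞ (chartAt E c).symm z :=
    (contMDiffOn_chart_symm (I := 𝓘(ℝ, E)) (n := ∞) (x := c)).contMDiffAt
      ((chartAt E c).open_target.mem_nhds hz)
  have h3 := (ContMDiffAt.comp z h1 h2).contDiffAt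
  refine (h3.congr_of_eventuallyEq ?_).contDiffWithinAt
  filter_upwards [(chartAt E c).open_target.mem_nhds hz] with w hw
  exact (trivializationAt E (TangentSpace 𝓘(ℝ, E)) c).continuousLinearMapAt_apply_of_mem ℝ
    ((chartAt E c).map_target hw) _

theorem surjective_fderiv_transition {c d x : M} (hc : x ∈ (chartAt E c).source)
    (hd : x ∈ (chartAt E d).source) :
    Function.Surjective (fderiv ℝ (transition c d) (chartAt E c x)) := fun u ↦
  ⟨toCoord c x (ofCoord d x u), by
    rw [fderiv_transition hc hd, ofCoord_toCoord_of_mem hc, toCoord_ofCoord_of_mem hd]⟩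

theorem isVectorField_completeLift {F : ∀ x : M, TangentSpace 𝓘(ℝ, E) x}
    (hF : ContMDiff 𝓘(ℝ, E) 𝓘(ℝ, E).tangent ∞ (fun x ↦ (⟨x, F x⟩ : TangentBundle 𝓘(ℝ, E) M))) :
    IsVectorField (tbChart (M := M)) (fun c ↦ completeLift (fieldInChart F c)) where
  contDiffOn c := by
    rw [tbChart_target]
    exact (contDiffOn_completeLift (chartAt E c).open_target (contDiffOn_fieldInChart hF c)).of_le
      (WithTop.coe_le_coe.2 le_top)
  compat c d ξ hc hd := by
    have hc' := mem_tbChart_source.1 hc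
    have hd' := mem_tbChart_source.1 hd
    have hφ := contDiffAt_transition hc' hd'
    have ht := transition_apply (d := d) hc'
    have hf : ∀ d, ξ.proj ∈ (chartAt E d).source →
        DifferentiableAt ℝ (fieldInChart F d) (chartAt E d ξ.proj) := fun d hd ↦
      ((contDiffOn_fieldInChart hF d).contDiffAt ((chartAt E d).open_target.mem_nhds
        ((chartAt E d).map_source hd))).differentiableAt (by simp)
    have h1 := tbChart_comp_symm_eventuallyEq hc hd
    have h2 := hasFDerivAt_tangentTransition hφ (toCoord c ξ.proj ξ.2)
    have h3 := completeLift_tangentTransition hφ (hf c hc') (by rw [ht]; exact hf d hd')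
      (eventually_fieldInChart_transition F hc' hd') (toCoord c ξ.proj ξ.2)
    have h4 : tangentTransition (transition c d) (tbChart c ξ) = tbChart d ξ := by
      rw [← h1.self_of_nhds, Function.comp_apply, (tbChart c).left_inv hc]
    rw [← tbChart_apply hc'] at h2 h3
    exact ⟨_, h2.congr_of_eventuallyEq h1, by rw [← h2.fderiv, h3, h4]⟩

theorem exists_mem_tbChart_source (ξ : TangentBundle 𝓘(ℝ, E) M) :
    ∃ c, ξ ∈ (tbChart (M := M) c).source :=
  ⟨ξ.proj, mem_tbChart_source.2 (mem_chart_source E _)⟩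

theorem toCoord_velocity {γ : ℝ → M} {t : ℝ}
    (hγ : MDifferentiableAt 𝓘(ℝ, ℝ) 𝓘(ℝ, E) γ t) {c : M} (hc : γ t ∈ (chartAt E c).source) :
    HasDerivAt (chartAt E c ∘ γ) (toCoord c (γ t) (velocity γ t)) t := by
  have h2 : MDifferentiableAt 𝓘(ℝ, E) 𝓘(ℝ, E) (chartAt E c) (γ t) :=
    mdifferentiableAt_extChartAt (I := 𝓘(ℝ, E)) hc
  have h3 : mfderiv 𝓘(ℝ, E) 𝓘(ℝ, E) (chartAt E c) (γ t) = toCoord c (γ t) :=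
    (TangentBundle.continuousLinearMapAt_trivializationAt hc).symm
  have h4 := h2.hasMFDerivAt.comp t hγ.hasMFDerivAt
  rw [h3] at h4
  let L : ℝ →L[ℝ] E := (toCoord c (γ t)).comp (mfderiv 𝓘(ℝ, ℝ) 𝓘(ℝ, E) γ t)
  have h5 : HasFDerivAt (chartAt E c ∘ γ) L t := h4.hasFDerivAt
  exact h5.hasDerivAt

/-! ### Fibrewise linearity of the complete lift -/

/-- The linear combination of two tangent vectors with the same base point. -/
def fiberComb (a b : ℝ) (ξ η : TangentBundle 𝓘(ℝ, E) M) : TangentBundle 𝓘(ℝ, E) M :=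
  ⟨ξ.proj, a • ξ.2 + b • ofCoord ξ.proj ξ.proj (toCoord ξ.proj η.proj η.2)⟩

theorem fiberComb_mk (a b : ℝ) (x : M) (v w : TangentSpace 𝓘(ℝ, E) x) :
    fiberComb a b (⟨x, v⟩ : TangentBundle 𝓘(ℝ, E) M) ⟨x, w⟩ = ⟨x, a • v + b • w⟩ := by
  simp only [fiberComb, ofCoord_toCoord]

theorem tbChart_fiberComb (a b : ℝ) {ξ η : TangentBundle 𝓘(ℝ, E) M} (h : ξ.proj = η.proj) {c : M}
    (hc : ξ.proj ∈ (chartAt E c).source) : tbChart c (fiberComb a b ξ η) =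
      ((tbChart c ξ).1, a • (tbChart c ξ).2 + b • (tbChart c η).2) := by
  obtain ⟨x, v⟩ := ξ
  obtain ⟨y, w⟩ := η
  obtain rfl : x = y := h
  have hv := fun v : TangentSpace 𝓘(ℝ, E) x ↦
    tbChart_apply (c := c) (ξ := (⟨x, v⟩ : TangentBundle 𝓘(ℝ, E) M)) hc
  simp only [fiberComb_mk, hv, map_add, map_smul]

/-- Over a fixed base curve, the fibre component of the complete lift's equation is the linear
equation u' = Df(z) u. -/
theorem isSolAt_fiberComb {F : ∀ x : M, TangentSpace 𝓘(ℝ, E) x}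
    (hF : ContMDiff 𝓘(ℝ, E) 𝓘(ℝ, E).tangent ∞ (fun x ↦ (⟨x, F x⟩ : TangentBundle 𝓘(ℝ, E) M)))
    (a b : ℝ) {α β : ℝ → TangentBundle 𝓘(ℝ, E) M} {t : ℝ}
    (hα : IsSolAt tbChart (fun c ↦ completeLift (fieldInChart F c)) α t)
    (hβ : IsSolAt tbChart (fun c ↦ completeLift (fieldInChart F c)) β t)
    (h : ∀ᶠ s in 𝓝 t, (α s).proj = (β s).proj) :
    IsSolAt tbChart (fun c ↦ completeLift (fieldInChart F c))
      (fun s ↦ fiberComb a b (α s) (β s)) t := by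
  set c := (α t).proj
  have hc : (α t).proj ∈ (chartAt E c).source := mem_chart_source E _
  have hX := isVectorField_completeLift hF
  have h1 := hX.hasDerivAt hα (j := c) (mem_tbChart_source.2 hc)
  have h2 := hX.hasDerivAt hβ (j := c) (mem_tbChart_source.2 (h.self_of_nhds ▸ hc))
  have hsrc : ∀ᶠ s in 𝓝 t, α s ∈ (tbChart c).source :=
    hα.1.preimage_mem_nhds ((tbChart c).open_source.mem_nhds (mem_tbChart_source.2 hc))
  have hchart : tbChart c ∘ (fun s ↦ fiberComb a b (α s) (β s)) =ᶠ[𝓝 t] fun s ↦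
      ((tbChart c (α s)).1, a • (tbChart c (α s)).2 + b • (tbChart c (β s)).2) := by
    filter_upwards [h, hsrc] with s hs hs' using tbChart_fiberComb a b hs (mem_tbChart_source.1 hs')
  have h1' : HasDerivAt (fun s ↦ (tbChart c (α s)).2) _ t := h1.snd
  have h2' : HasDerivAt (fun s ↦ (tbChart c (β s)).2) _ t := h2.snd
  have h1'' : HasDerivAt (fun s ↦ (tbChart c (α s)).1) _ t := h1.fst
  have hd := (h1''.prodMk ((h1'.const_smul a).add (h2'.const_smul b))).congr_of_eventuallyEq hchart
  have hfst : (tbChart c (β t)).1 = (tbChart c (α t)).1 :=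
    congrArg (chartAt E c) h.self_of_nhds.symm
  refine ⟨?_, c, mem_tbChart_source.2 hc, ?_⟩
  · rw [(tbChart c).continuousAt_iff_continuousAt_comp_left]
    · exact hd.continuousAt
    · filter_upwards [hsrc] with s hs using mem_tbChart_source.2 (mem_tbChart_source.1 hs)
  · convert hd using 1
    rw [tbChart_fiberComb a b h.self_of_nhds hc]
    simp only [completeLift, hfst, map_add, map_smul]

/-- The base component of the complete lift is `F` itself, so its integral curves project to
integral curves of `F`. -/
theorem hasMFDerivAt_proj {F : ∀ x : M, TangentSpace 𝓘(ℝ, E) x}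
    (hF : ContMDiff 𝓘(ℝ, E) 𝓘(ℝ, E).tangent ∞ (fun x ↦ (⟨x, F x⟩ : TangentBundle 𝓘(ℝ, E) M)))
    {α : ℝ → TangentBundle 𝓘(ℝ, E) M} {t : ℝ}
    (hα : IsSolAt tbChart (fun c ↦ completeLift (fieldInChart F c)) α t) :
    HasMFDerivAt 𝓘(ℝ, ℝ) 𝓘(ℝ, E) (fun s ↦ (α s).proj) t
      ((1 : ℝ →L[ℝ] ℝ).smulRight (F (α t).proj)) := by
  have hc := mem_chart_source E (α t).proj
  have h1 : HasDerivAt (fun s ↦ (tbChart (α t).proj (α s)).1) _ t :=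
    ((isVectorField_completeLift hF).hasDerivAt hα (j := (α t).proj)
      (mem_tbChart_source.2 hc)).fst
  have h2 : (completeLift (fieldInChart F (α t).proj) (tbChart (α t).proj (α t))).1 =
      F (α t).proj := by
    rw [tbChart_apply hc, completeLift]
    dsimp only
    rw [fieldInChart_apply F hc, toCoord_apply hc]
    exact tangentCoordChange_self (I := 𝓘(ℝ, E)) (by simp)
  refine ⟨ContinuousAt.comp (g := TotalSpace.proj) (f := α)
    (FiberBundle.continuous_proj E (TangentSpace 𝓘(ℝ, E))).continuousAt hα.1, ?_⟩
  rw [h2] at h1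
  have h3 : ∀ (f : ℝ → E) (e : E), HasDerivAt f e t →
      HasFDerivWithinAt f ((1 : ℝ →L[ℝ] ℝ).smulRight e) (range 𝓘(ℝ, ℝ)) t := by
    intro f e h
    rw [show (1 : ℝ →L[ℝ] ℝ).smulRight e = ContinuousLinearMap.toSpanSingleton ℝ e by ext; simp]
    exact h.hasFDerivAt.hasFDerivWithinAt
  exact h3 _ _ h1

/-- The tangent vectors through which the complete lift of `F` has an integral curve defined on
`(-ε, ε)`. -/
def liftDomain (F : ∀ x : M, TangentSpace 𝓘(ℝ, E) x) (ε : ℝ) : Set (TangentBundle 𝓘(ℝ, E) M) :=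
  {ξ | ∃ α : ℝ → TangentBundle 𝓘(ℝ, E) M, α 0 = ξ ∧ ∀ t ∈ Ioo (-ε) ε,
    IsSolAt tbChart (fun c ↦ completeLift (fieldInChart F c)) α t}

theorem exists_isMIntegralCurveOn_of_mem_liftDomain {F : ∀ x : M, TangentSpace 𝓘(ℝ, E) x}
    (hF : ContMDiff 𝓘(ℝ, E) 𝓘(ℝ, E).tangent ∞ (fun x ↦ (⟨x, F x⟩ : TangentBundle 𝓘(ℝ, E) M)))
    {ε : ℝ} {ξ : TangentBundle 𝓘(ℝ, E) M} (hξ : ξ ∈ liftDomain F ε) :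
    ∃ γ : ℝ → M, γ 0 = ξ.proj ∧ IsMIntegralCurveOn γ F (Ioo (-ε) ε) := by
  obtain ⟨α, rfl, hα⟩ := hξ
  exact ⟨fun t ↦ (α t).proj, rfl, fun t ht ↦ (hasMFDerivAt_proj hF (hα t ht)).hasMFDerivWithinAt⟩

/-- Both lifted curves project to the integral curve of `F` through `x`, which is unique because `M`
is Hausdorff; they can therefore be combined fibrewise. -/
theorem smul_add_smul_mem_liftDomain [CompleteSpace E] [T2Space M]
    {F : ∀ x : M, TangentSpace 𝓘(ℝ, E) x}
    (hF : ContMDiff 𝓘(ℝ, E) 𝓘(ℝ, E).tangent ∞ (fun x ↦ (⟨x, F x⟩ : TangentBundle 𝓘(ℝ, E) M)))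
    {ε : ℝ} (hε : 0 < ε) (a b : ℝ) {x : M} {v w : TangentSpace 𝓘(ℝ, E) x}
    (hv : (⟨x, v⟩ : TangentBundle 𝓘(ℝ, E) M) ∈ liftDomain F ε)
    (hw : (⟨x, w⟩ : TangentBundle 𝓘(ℝ, E) M) ∈ liftDomain F ε) :
    (⟨x, a • v + b • w⟩ : TangentBundle 𝓘(ℝ, E) M) ∈ liftDomain F ε := by
  obtain ⟨α, hα0, hα⟩ := hv
  obtain ⟨β, hβ0, hβ⟩ := hw
  have heq := isMIntegralCurveOn_Ioo_eqOn_of_contMDiff_boundaryless (t₀ := 0)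
    (γ := fun t ↦ (α t).proj) (γ' := fun t ↦ (β t).proj) (a := -ε) (b := ε)
    ⟨by linarith, hε⟩ (hF.of_le (by simp))
    (fun t ht ↦ (hasMFDerivAt_proj hF (hα t ht)).hasMFDerivWithinAt)
    (fun t ht ↦ (hasMFDerivAt_proj hF (hβ t ht)).hasMFDerivWithinAt) (by simp [hα0, hβ0])
  exact ⟨fun t ↦ fiberComb a b (α t) (β t), by simp only [hα0, hβ0, fiberComb_mk], fun t ht ↦
    isSolAt_fiberComb hF a b (hα t ht) (hβ t ht)
      (Filter.eventually_of_mem (isOpen_Ioo.mem_nhds ht) heq)⟩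

/-- A linear subspace containing an open set is the whole space; this is applied in each fibre near
the base point of ξ. -/
theorem eventually_forall_mem_liftDomain [CompleteSpace E] [T2Space M]
    {F : ∀ x : M, TangentSpace 𝓘(ℝ, E) x}
    (hF : ContMDiff 𝓘(ℝ, E) 𝓘(ℝ, E).tangent ∞ (fun x ↦ (⟨x, F x⟩ : TangentBundle 𝓘(ℝ, E) M)))
    {ε : ℝ} (hε : 0 < ε) {ξ : TangentBundle 𝓘(ℝ, E) M} (h : liftDomain F ε ∈ 𝓝 ξ) :
    ∀ᶠ x in 𝓝 ξ.proj, ∀ v, (⟨x, v⟩ : TangentBundle 𝓘(ℝ, E) M) ∈ liftDomain F ε := by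
  set c := ξ.proj
  have hc : ξ.proj ∈ (chartAt E c).source := mem_chart_source E _
  have hξ := mem_tbChart_source.2 hc
  have h1 : (tbChart c).symm ⁻¹' liftDomain F ε ∈ 𝓝 (tbChart c ξ) :=
    ((tbChart c).continuousAt_symm ((tbChart c).map_source hξ)).preimage_mem_nhds
      (by rwa [(tbChart c).left_inv hξ])
  rw [tbChart_apply hc] at h1
  obtain ⟨A, hA, B, hB, hAB⟩ := mem_nhds_prod_iff.1 h1
  filter_upwards [(chartAt E c).open_source.mem_nhds hc,
    ((chartAt E c).continuousAt hc).preimage_mem_nhds hA] with x hx hxA v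
  have hmem : ∀ u ∈ B, (⟨x, ofCoord c x u⟩ : TangentBundle 𝓘(ℝ, E) M) ∈ liftDomain F ε := by
    intro u hu
    have h2 := hAB (mk_mem_prod hxA hu)
    have h3 := (tbChart c).left_inv (x := ⟨x, ofCoord c x u⟩) (mem_tbChart_source.2 hx)
    rw [tbChart_apply hx, toCoord_ofCoord_of_mem hx] at h3
    rwa [mem_preimage, h3] at h2
  set V := toCoord c ξ.proj ξ.2
  -- For small nonzero `k` both `V` and `V + k v` lie in `B`, and v = k⁻¹((V + k v) - V).
  have hlim : ContinuousAt (fun k : ℝ ↦ V + k • toCoord c x v) 0 := by fun_prop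
  have hev : ∀ᶠ k : ℝ in 𝓝[≠] 0, V + k • toCoord c x v ∈ B :=
    (hlim.eventually_mem (by simpa using hB)).filter_mono nhdsWithin_le_nhds
  obtain ⟨k, hk, hk0⟩ := (hev.and self_mem_nhdsWithin).exists
  have := smul_add_smul_mem_liftDomain hF hε (k⁻¹) (-k⁻¹) (hmem _ hk) (hmem V (mem_of_mem_nhds hB))
  rw [map_add, map_smul, ofCoord_toCoord_of_mem hx, smul_add, smul_smul,
    inv_mul_cancel₀ (show k ≠ 0 from hk0), one_smul, neg_smul, add_neg_cancel_comm] at this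
  exact this

end Charts

/-! ### The geodesic spray of a Riemannian manifold and Killing fields in charts -/

section Riemannian

variable {E : Type*} [NormedAddCommGroup E] [NormedSpace ℝ E]
  {M : Type*} [TopologicalSpace M] [ChartedSpace E M] [IsManifold 𝓘(ℝ, E) ∞ M]
  [RiemannianBundle (fun x : M ↦ TangentSpace 𝓘(ℝ, E) x)]

theorem metricInChart_chartAt {c x : M} (hx : x ∈ (chartAt E c).source) (u v : E) :
    metricInChart c (chartAt E c x) u v = inner ℝ (ofCoord c x u) (ofCoord c x v) := by
  have h : (extChartAt 𝓘(ℝ, E) c).symm (chartAt E c x) = x := (chartAt E c).left_inv hx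
  rw [metricInChart_apply, h]

/-- Riesz representation in the tangent space, which is complete because the trivialization is a
linear homeomorphism onto `E`. -/
theorem isInvertible_metricInChart [CompleteSpace E] {c : M} {z : E}
    (hz : z ∈ (chartAt E c).target) : (metricInChart c z).IsInvertible := by
  set x := (extChartAt 𝓘(ℝ, E) c).symm z
  have hx : x ∈ (chartAt E c).source := (chartAt E c).map_target hz
  let e : TangentSpace 𝓘(ℝ, E) x ≃L[ℝ] E :=
    (trivializationAt E (TangentSpace 𝓘(ℝ, E)) c).continuousLinearEquivAt ℝ x hx
  have : CompleteSpace (TangentSpace 𝓘(ℝ, E) x) :=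
    (completeSpace_congr (e := e.toEquiv) e.isUniformEmbedding).2 inferInstance
  let D : TangentSpace 𝓘(ℝ, E) x ≃L[ℝ] (TangentSpace 𝓘(ℝ, E) x →L[ℝ] ℝ) :=
    (InnerProductSpace.toDual ℝ (TangentSpace 𝓘(ℝ, E) x)).toContinuousLinearEquiv
  refine ⟨(e.symm.trans D).trans (e.arrowCongr (ContinuousLinearEquiv.refl ℝ ℝ)), ?_⟩
  ext u v
  have he : ∀ u, e.symm u = ofCoord c x u := fun u ↦
    congrFun (Trivialization.symm_continuousLinearEquivAt_eq _ hx) u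
  rw [metricInChart_apply]
  change (D (e.symm u)) (e.symm v) = inner ℝ (ofCoord c x u) (ofCoord c x v)
  rw [he, he]
  exact InnerProductSpace.toDual_apply_apply

theorem contDiffOn_metricInChart
    [IsContMDiffRiemannianBundle 𝓘(ℝ, E) ∞ E (fun x : M ↦ TangentSpace 𝓘(ℝ, E) x)] (c : M) :
    ContDiffOn ℝ ∞ (metricInChart c) (chartAt E c).target := by
  obtain ⟨g, hg, hgi⟩ := IsContMDiffRiemannianBundle.exists_contMDiff (IB := 𝓘(ℝ, E)) (n := ∞)
    (F := E) (E := fun x : M ↦ TangentSpace 𝓘(ℝ, E) x)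
  intro z hz
  have hx := (chartAt E c).map_target hz
  let e := trivializationAt (E →L[ℝ] E →L[ℝ] ℝ)
    (fun x : M ↦ TangentSpace 𝓘(ℝ, E) x →L[ℝ] TangentSpace 𝓘(ℝ, E) x →L[ℝ] ℝ) c
  have h1 := (e.contMDiffAt_section_iff (IB := 𝓘(ℝ, E)) (n := ∞) (s := g)
    (x₀ := (chartAt E c).symm z) ⟨hx, hx, mem_univ _⟩).1 hg.contMDiffAt
  have h2 : ContMDiffAt 𝓘(ℝ, E) 𝓘(ℝ, E) ∞ (chartAt E c).symm z :=
    (contMDiffOn_chart_symm (I := 𝓘(ℝ, E)) (n := ∞) (x := c)).contMDiffAt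
      ((chartAt E c).open_target.mem_nhds hz)
  have h3 := (ContMDiffAt.comp z h1 h2).contDiffAt
  refine (h3.congr_of_eventuallyEq ?_).contDiffWithinAt
  filter_upwards [(chartAt E c).open_target.mem_nhds hz] with w hw
  have hy := (chartAt E c).map_target hw
  ext u v
  rw [metricInChart_apply, hgi]
  have := inCoordinates_apply_eq₂ (𝕜 := ℝ) (F₁ := E) (F₂ := E) (F₃ := ℝ)
    (E₁ := fun x : M ↦ TangentSpace 𝓘(ℝ, E) x) (E₂ := fun x : M ↦ TangentSpace 𝓘(ℝ, E) x)
    (E₃ := fun _ : M ↦ ℝ) (x₀ := c) (x := (chartAt E c).symm w)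
    (ϕ := g ((chartAt E c).symm w)) (v := u) (w := v) hy hy (mem_univ _)
  rw [← Trivialization.symmL_apply (R := ℝ) _ hy, ← Trivialization.symmL_apply (R := ℝ) _ hy]
    at this
  have hid : (trivializationAt ℝ (fun _ : M ↦ ℝ) c).linearMapAt ℝ ((chartAt E c).symm w) =
    LinearMap.id := Bundle.Trivial.linearMapAt_trivialization ℝ M ℝ _
  rw [hid] at this
  exact this.symm

theorem isStrongMetricOn_metricInChart [CompleteSpace E]
    [IsContMDiffRiemannianBundle 𝓘(ℝ, E) ∞ E (fun x : M ↦ TangentSpace 𝓘(ℝ, E) x)] (c : M) :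
    IsStrongMetricOn (metricInChart c) (chartAt E c).target where
  isOpen := (chartAt E c).open_target
  contDiffOn := contDiffOn_metricInChart c
  symm z _ u v := by rw [metricInChart_apply, metricInChart_apply, real_inner_comm]
  isInvertible _ hz := isInvertible_metricInChart hz

theorem eventually_metricInChart_transition {c d x : M} (hc : x ∈ (chartAt E c).source)
    (hd : x ∈ (chartAt E d).source) :
    ∀ᶠ z in 𝓝 (chartAt E c x), ∀ u v, metricInChart c z u v =
      metricInChart d (transition c d z) (fderiv ℝ (transition c d) z u)
        (fderiv ℝ (transition c d) z v) := by
  filter_upwards [eventually_chartAt_symm_mem hc hd] with z hz u v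
  obtain ⟨y, hyc, hyd, rfl⟩ := hz
  rw [transition_apply hyc, metricInChart_chartAt hyc, metricInChart_chartAt hyd,
    fderiv_transition hyc hyd, fderiv_transition hyc hyd, ofCoord_toCoord_of_mem hyd,
    ofCoord_toCoord_of_mem hyd]

/-- At the centre of its own chart the connection is ∂ + Γ; symmetrising g(∇F, ·) turns the
Christoffel terms into the derivative of the metric along `F`. -/
theorem lieDerivMetric_self_eq_zero [CompleteSpace E]
    [IsContMDiffRiemannianBundle 𝓘(ℝ, E) ∞ E (fun x : M ↦ TangentSpace 𝓘(ℝ, E) x)]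
    {F : ∀ x : M, TangentSpace 𝓘(ℝ, E) x} (hF : IsKillingField F) (x : M) (a b : E) :
    lieDerivMetric (metricInChart x) (fieldInChart F x) (chartAt E x x) a b = 0 := by
  have hx := mem_chart_source E x
  have hz : chartAt E x x ∈ (chartAt E x).target := mem_chart_target E x
  have hG := isStrongMetricOn_metricInChart (E := E) x
  have hf : DifferentiableAt ℝ (fieldInChart F x) (chartAt E x x) :=
    ((contDiffOn_fieldInChart hF.contMDiff x).contDiffAt
      ((chartAt E x).open_target.mem_nhds hz)).differentiableAt (by simp)
  have hnabla : ∀ u, leviCivita E M F x (ofCoord x x u) = ofCoord x x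
      (fderiv ℝ (fieldInChart F x) (chartAt E x x) u +
        christoffel (metricInChart x) (chartAt E x x) u (fieldInChart F x (chartAt E x x))) := by
    intro u
    have h1 : mvfderiv 𝓘(ℝ, E) (fun y ↦ toCoord x y (F y)) x (ofCoord x x u) =
        fderiv ℝ (fieldInChart F x) (chartAt E x x) u := by
      have h2 : MDifferentiableAt 𝓘(ℝ, E) 𝓘(ℝ, E) (chartAt E x) x :=
        mdifferentiableAt_extChartAt (I := 𝓘(ℝ, E)) hx
      have h3 : mfderiv 𝓘(ℝ, E) 𝓘(ℝ, E) (chartAt E x) x = toCoord x x :=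
        (TangentBundle.continuousLinearMapAt_trivializationAt hx).symm
      have h4 : HasMFDerivAt 𝓘(ℝ, E) 𝓘(ℝ, E) (fun y ↦ toCoord x y (F y)) x
          ((fderiv ℝ (fieldInChart F x) (chartAt E x x)).comp (toCoord x x)) := by
        have := hf.hasFDerivAt.hasMFDerivAt.comp x h2.hasMFDerivAt
        rw [h3] at this
        refine this.congr_of_eventuallyEq ?_
        filter_upwards [(chartAt E x).open_source.mem_nhds hx] with y hy
        exact (fieldInChart_apply F hy).symm
      rw [mvfderiv, h4.mfderiv]
      change fderiv ℝ (fieldInChart F x) (chartAt E x x) (toCoord x x (ofCoord x x u)) = _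
      rw [toCoord_ofCoord_of_mem hx]
    change ofCoord x x (mvfderiv 𝓘(ℝ, E) (fun y ↦ toCoord x y (F y)) x (ofCoord x x u) +
      christoffel (metricInChart x) (chartAt E x x) (toCoord x x (ofCoord x x u))
        (toCoord x x (F x))) = _
    rw [h1, toCoord_ofCoord_of_mem hx, fieldInChart_apply F hx]
  have h1 := hF.killing_equation x (ofCoord x x a) (ofCoord x x b)
  rw [hnabla, hnabla, ← metricInChart_chartAt hx, ← metricInChart_chartAt hx] at h1
  simp only [map_add, add_apply] at h1
  rw [hG.christoffel_spec hz, hG.christoffel_spec hz] at h1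
  rw [lieDerivMetric, hG.symm _ hz a]
  have h2 := hG.fderiv_symm hz a (fieldInChart F x (chartAt E x x)) b
  have h3 := hG.fderiv_symm hz b (fieldInChart F x (chartAt E x x)) a
  have h4 := hG.fderiv_symm hz (fieldInChart F x (chartAt E x x)) b a
  linarith

theorem lieDerivMetric_eq_zero [CompleteSpace E]
    [IsContMDiffRiemannianBundle 𝓘(ℝ, E) ∞ E (fun x : M ↦ TangentSpace 𝓘(ℝ, E) x)]
    {F : ∀ x : M, TangentSpace 𝓘(ℝ, E) x} (hF : IsKillingField F) (c : M) {z : E}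
    (hz : z ∈ (chartAt E c).target) (a b : E) :
    lieDerivMetric (metricInChart c) (fieldInChart F c) z a b = 0 := by
  obtain ⟨x, hx, rfl⟩ : ∃ x ∈ (chartAt E c).source, chartAt E c x = z :=
    ⟨_, (chartAt E c).map_target hz, (chartAt E c).right_inv hz⟩
  have hxx := mem_chart_source E x
  have ht := transition_apply (E := E) (d := x) hx
  have hf : ∀ d, x ∈ (chartAt E d).source →
      DifferentiableAt ℝ (fieldInChart F d) (chartAt E d x) := fun d hd ↦
    ((contDiffOn_fieldInChart hF.contMDiff d).contDiffAt
      ((chartAt E d).open_target.mem_nhds ((chartAt E d).map_source hd))).differentiableAt (by simp)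
  rw [lieDerivMetric_transition (isStrongMetricOn_metricInChart c)
    (isStrongMetricOn_metricInChart x) (contDiffAt_transition hx hxx) hz
    (by rw [ht]; exact mem_chart_target E x) (eventually_metricInChart_transition hx hxx)
    (hf c hx) (by rw [ht]; exact hf x hxx) (eventually_fieldInChart_transition F hx hxx), ht]
  exact lieDerivMetric_self_eq_zero hF x _ _

theorem isVectorField_spray [CompleteSpace E]
    [IsContMDiffRiemannianBundle 𝓘(ℝ, E) ∞ E (fun x : M ↦ TangentSpace 𝓘(ℝ, E) x)] :
    IsVectorField (tbChart (M := M)) (fun c ↦ spray (metricInChart (E := E) c)) where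
  contDiffOn c := by
    rw [tbChart_target]
    exact (isStrongMetricOn_metricInChart c).contDiffOn_spray.of_le (WithTop.coe_le_coe.2 le_top)
  compat c d ξ hc hd := by
    have hc' := mem_tbChart_source.1 hc
    have hd' := mem_tbChart_source.1 hd
    have hφ := contDiffAt_transition hc' hd'
    have ht := transition_apply (d := d) hc'
    have h1 := tbChart_comp_symm_eventuallyEq hc hd
    have h2 := hasFDerivAt_tangentTransition hφ (toCoord c ξ.proj ξ.2)
    have h3 := spray_tangentTransition (isStrongMetricOn_metricInChart c)
      (isStrongMetricOn_metricInChart d) hφ ((chartAt E c).map_source hc')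
      (by rw [ht]; exact (chartAt E d).map_source hd') (surjective_fderiv_transition hc' hd')
      (eventually_metricInChart_transition hc' hd') (toCoord c ξ.proj ξ.2)
    have h4 : tangentTransition (transition c d) (tbChart c ξ) = tbChart d ξ := by
      rw [← h1.self_of_nhds, Function.comp_apply, (tbChart c).left_inv hc]
    rw [← tbChart_apply hc'] at h2 h3
    exact ⟨_, h2.congr_of_eventuallyEq h1, by rw [← h2.fderiv, h3, h4]⟩

theorem fderiv_spray_completeLift_fieldInChart [CompleteSpace E]
    [IsContMDiffRiemannianBundle 𝓘(ℝ, E) ∞ E (fun x : M ↦ TangentSpace 𝓘(ℝ, E) x)]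
    {F : ∀ x : M, TangentSpace 𝓘(ℝ, E) x} (hF : IsKillingField F) (c : M) {p : E × E}
    (hp : p ∈ (tbChart (M := M) c).target) :
    fderiv ℝ (spray (metricInChart c)) p (completeLift (fieldInChart F c) p) =
      fderiv ℝ (completeLift (fieldInChart F c)) p (spray (metricInChart c) p) :=
  fderiv_spray_completeLift (isStrongMetricOn_metricInChart c)
    (contDiffOn_fieldInChart hF.contMDiff c) (fun _ hy ↦ lieDerivMetric_eq_zero hF c hy)
    (mem_tbChart_target.1 hp) p.2

/-- `IsSolAt` asks for a single chart at each time, and the chart at `γ t` is the one in which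
`covDerivAlong` is defined. -/
theorem IsGeodesic.isSolAt {γ : ℝ → M} (hγ : IsGeodesic E γ) (t : ℝ) :
    IsSolAt (tbChart (M := M)) (fun c ↦ spray (metricInChart (E := E) c))
      (fun t ↦ ⟨γ t, velocity γ t⟩) t := by
  have hc := mem_chart_source E (γ t)
  have hd : ∀ s, MDifferentiableAt 𝓘(ℝ, ℝ) 𝓘(ℝ, E) γ s := fun s ↦
    hγ.contMDiff.contMDiffAt.mdifferentiableAt (by simp)
  have hsrc : γ ⁻¹' (chartAt E (γ t)).source ∈ 𝓝 t :=
    hγ.contMDiff.continuous.continuousAt.preimage_mem_nhds ((chartAt E (γ t)).open_source.mem_nhds hc)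
  set u : ℝ → E := fun s ↦ toCoord (γ t) (γ s) (velocity γ s)
  have hu : u =ᶠ[𝓝 t] deriv (chartAt E (γ t) ∘ γ) := by
    filter_upwards [hsrc] with s hs using (toCoord_velocity (hd s) hs).deriv.symm
  have hsmooth : ContDiffAt ℝ ∞ (chartAt E (γ t) ∘ γ) t :=
    (ContMDiffAt.comp t (contMDiffAt_extChartAt' (I := 𝓘(ℝ, E)) hc)
      hγ.contMDiff.contMDiffAt).contDiffAt
  have hud : DifferentiableAt ℝ u t := by
    refine DifferentiableAt.congr_of_eventuallyEq ?_ hu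
    exact ((hsmooth.fderiv_right (m := ∞) (by simp)).differentiableAt (by simp)).clm_apply
      (differentiableAt_const (1 : ℝ))
  have hgeo := congrArg (toCoord (γ t) (γ t)) (hγ.covDerivAlong_velocity t)
  rw [covDerivAlong, toCoord_ofCoord_of_mem hc, map_zero] at hgeo
  have hchart : tbChart (γ t) ∘ (fun s ↦ (⟨γ s, velocity γ s⟩ : TangentBundle 𝓘(ℝ, E) M)) =ᶠ[𝓝 t]
      fun s ↦ (chartAt E (γ t) (γ s), u s) := by
    filter_upwards [hsrc] with s hs using tbChart_apply hs
  have hderiv := ((toCoord_velocity (hd t) hc).prodMk hud.hasDerivAt).congr_of_eventuallyEq hchart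
  have hsrc' := mem_tbChart_source (ξ := (⟨γ t, velocity γ t⟩ : TangentBundle 𝓘(ℝ, E) M)).2 hc
  refine ⟨?_, γ t, hsrc', ?_⟩
  · rw [(tbChart (γ t)).continuousAt_iff_continuousAt_comp_left]
    · exact hderiv.continuousAt
    · filter_upwards [hsrc] with s hs using mem_tbChart_source.2 hs
  · convert hderiv using 1
    rw [tbChart_apply hc]
    exact Prod.ext rfl (eq_neg_of_add_eq_zero_left hgeo).symm

/-- The geodesic flow of a geodesically complete manifold. -/
theorem GeodesicallyComplete.exists_isGlobalFlow (hM : GeodesicallyComplete E M) :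
    ∃ Φ : TangentBundle 𝓘(ℝ, E) M → ℝ → TangentBundle 𝓘(ℝ, E) M,
      IsGlobalFlow (tbChart (M := M)) (fun c ↦ spray (metricInChart (E := E) c)) Φ := by
  choose γ hγ h0 using hM
  exact ⟨fun ξ t ↦ ⟨γ ξ t, velocity (γ ξ) t⟩, h0, fun ξ t ↦ (hγ ξ).isSolAt t⟩

/-! ### Closed sets swept out by geodesics -/

theorem norm_sub_sub_smul_le_of_norm_deriv_le {z u : ℝ → E} {a : ℝ → E} {K s : ℝ} (hs : 0 ≤ s)
    (hz : ∀ t ∈ Icc 0 s, HasDerivAt z (u t) t) (hu : ∀ t ∈ Icc 0 s, HasDerivAt u (a t) t)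
    (hK : ∀ t ∈ Icc 0 s, ‖a t‖ ≤ K) : ‖z s - z 0 - s • u 0‖ ≤ K * s * s := by
  have hK0 : 0 ≤ K := (norm_nonneg _).trans (hK 0 ⟨le_rfl, hs⟩)
  have h1 : ∀ t ∈ Icc 0 s, ‖u t - u 0‖ ≤ K * s := fun t ht ↦ by
    have := norm_image_sub_le_of_norm_deriv_le_segment' (f := u) (f' := a) (C := K)
      (fun x hx ↦ (hu x hx).hasDerivWithinAt) (fun x hx ↦ hK x (Ico_subset_Icc_self hx)) t ht
    refine this.trans ?_
    rw [sub_zero]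
    exact mul_le_mul_of_nonneg_left ht.2 hK0
  have h2 := norm_image_sub_le_of_norm_deriv_le_segment' (f := fun t ↦ z t - t • u 0)
    (f' := fun t ↦ u t - u 0) (C := K * s) (a := 0) (b := s)
    (fun x hx ↦ by
      have := (hz x hx).sub ((hasDerivAt_id x).smul_const (u 0))
      simp only [one_smul] at this
      exact this.hasDerivWithinAt)
    (fun x hx ↦ h1 x (Ico_subset_Icc_self hx)) s ⟨hs, le_rfl⟩
  simp only [zero_smul, sub_zero] at h2
  rwa [sub_right_comm]

/-- A closed set which is a union of geodesics is open. -/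
theorem isOpen_of_isClosed_of_flow_invariant [CompleteSpace E] [T2Space M]
    [IsContMDiffRiemannianBundle 𝓘(ℝ, E) ∞ E (fun x : M ↦ TangentSpace 𝓘(ℝ, E) x)]
    {Φ : TangentBundle 𝓘(ℝ, E) M → ℝ → TangentBundle 𝓘(ℝ, E) M}
    (hΦ : IsGlobalFlow (tbChart (M := M)) (fun c ↦ spray (metricInChart (E := E) c)) Φ)
    {Z : Set M} (hZ : IsClosed Z)
    (hinv : ∀ ξ : TangentBundle 𝓘(ℝ, E) M, ξ.proj ∈ Z → ∀ s, (Φ ξ s).proj ∈ Z) : IsOpen Z := by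
  refine isOpen_iff_mem_nhds.2 fun y hy ↦ ?_
  set z₀ := chartAt E y y with hz₀
  have hys := mem_chart_source E y
  have hz₀t : z₀ ∈ (chartAt E y).target := mem_chart_target E y
  have hp₀ : ((z₀, 0) : E × E) ∈ (tbChart (M := M) y).target := mem_tbChart_target.2 hz₀t
  have hS := (isVectorField_spray (E := E) (M := M)).contDiffAt (i := y) hp₀
  set K := ‖spray (metricInChart y) (z₀, 0)‖ + 1
  have hK : 0 < K := by positivity
  have hW : {p : E × E | ‖spray (metricInChart y) p‖ < K} ∈ 𝓝 ((z₀, 0) : E × E) :=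
    hS.continuousAt.norm.eventually_lt_const (lt_add_one _)
  obtain ⟨α, U, hUo, hzU, ε, hε, -, hα⟩ := exists_localFlow (hS.of_le one_le_two)
    (Filter.inter_mem ((tbChart (M := M) y).open_target.mem_nhds hp₀) hW)
  obtain ⟨r₁, hr₁, hrU⟩ := Metric.mem_nhds_iff.1 (hUo.mem_nhds hzU)
  obtain ⟨R, hR, hRt⟩ := Metric.mem_nhds_iff.1 ((chartAt E y).open_target.mem_nhds hz₀t)
  obtain ⟨r, hr, hrr⟩ := exists_between hr₁
  -- The bounds on ρ ensure, in order: the initial vector lies in the domain `U` of the local flow,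
  -- the ball of radius 2ρ lies in the chart, the shooting time is below ε, and the second-order
  -- error 4Kρd/r² is below the distance d.
  obtain ⟨ρ, hρ, hρb⟩ := exists_between (show 0 < min (min (r / 3) (R / 3))
    (min (r * ε / 2) (r ^ 2 / (4 * K))) by positivity)
  obtain ⟨⟨h1, h2⟩, h3, h4⟩ : (ρ < r / 3 ∧ ρ < R / 3) ∧ ρ < r * ε / 2 ∧ ρ < r ^ 2 / (4 * K) := by
    simpa only [lt_min_iff] using hρb
  rw [lt_div_iff₀ (by positivity)] at h4
  have hball : Metric.closedBall z₀ (2 * ρ) ⊆ (chartAt E y).target :=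
    (Metric.closedBall_subset_ball (by linarith)).trans hRt
  set Zc := Metric.closedBall z₀ (2 * ρ) ∩ (chartAt E y).symm ⁻¹' Z
  have hZc : IsClosed Zc := ((chartAt E y).continuousOn_symm.mono hball).preimage_isClosed_of_isClosed
    Metric.isClosed_closedBall hZ
  have hz₀Z : z₀ ∈ Zc := ⟨Metric.mem_closedBall_self (by linarith), by
    rw [mem_preimage, hz₀, (chartAt E y).left_inv hys]; exact hy⟩
  -- If `o` were outside, at distance d from `Zc`, choose z in `Zc` with l = |o - z| < 2d. The
  -- geodesic from z with coordinate velocity of norm `r` towards `o` would reach `o` at time l/r if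
  -- it were straight; its acceleration is at most `K`, so it misses by at most K(l/r)² < d. Its
  -- endpoint is again in `Zc`: a contradiction. A nearest point need not exist, but a factor 2
  -- suffices since the error is quadratic.
  have main : ∀ o ∈ Metric.ball z₀ ρ, o ∈ Zc := by
    intro o ho
    by_contra hoZ
    have hd : 0 < Metric.infDist o Zc := (hZc.notMem_iff_infDist_pos ⟨z₀, hz₀Z⟩).1 hoZ
    have hdρ : Metric.infDist o Zc < ρ :=
      (Metric.infDist_le_dist_of_mem hz₀Z).trans_lt ho
    obtain ⟨z, hzZ, hz⟩ := (Metric.infDist_lt_iff ⟨z₀, hz₀Z⟩).1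
      (show Metric.infDist o Zc < 2 * Metric.infDist o Zc by linarith)
    have hdz := Metric.infDist_le_dist_of_mem (x := o) hzZ
    set d := Metric.infDist o Zc
    set l := dist o z with hl
    have hl0 : 0 < l := hd.trans_le hdz
    set u := (r / l) • (o - z) with hu
    have hun : ‖u‖ = r := by
      rw [hu, norm_smul, ← dist_eq_norm, ← hl, Real.norm_of_nonneg (by positivity)]
      field_simp
    have hpU : (z, u) ∈ U := by
      refine hrU ?_
      rw [Metric.mem_ball, Prod.dist_eq, max_lt_iff, dist_zero_right, hun]
      refine ⟨?_, hrr⟩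
      have := Metric.mem_closedBall.1 hzZ.1
      linarith
    set s := l / r with hsdef
    have hs0 : 0 ≤ s := by positivity
    have hsε : s < ε := by
      rw [hsdef, div_lt_iff₀ hr]
      linarith
    have hI : ∀ t ∈ Icc 0 s, t ∈ Ioo (-ε) ε := fun t ht ↦ ⟨by linarith [ht.1], by linarith [ht.2]⟩
    have hest := norm_sub_sub_smul_le_of_norm_deriv_le (K := K) (s := s)
      (z := fun t ↦ (α ((z, u), t)).1) (u := fun t ↦ (α ((z, u), t)).2)
      (a := fun t ↦ (spray (metricInChart y) (α ((z, u), t))).2) hs0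
      (fun t ht ↦ ((hα _ hpU).2 t (hI t ht)).1.fst) (fun t ht ↦ ((hα _ hpU).2 t (hI t ht)).1.snd)
      (fun t ht ↦ (norm_snd_le _).trans (le_of_lt ((hα _ hpU).2 t (hI t ht)).2.2))
    have hsu : s • u = o - z := by
      rw [hu, smul_smul, hsdef, show l / r * (r / l) = 1 by field_simp, one_smul]
    simp only [(hα _ hpU).1, hsu] at hest
    have hpos : dist o (α ((z, u), s)).1 < d := by
      rw [dist_comm, dist_eq_norm]
      calc ‖(α ((z, u), s)).1 - o‖ = ‖(α ((z, u), s)).1 - z - (o - z)‖ := by congr 1; abel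
        _ ≤ K * s * s := hest
        _ = K * l * l / r ^ 2 := by rw [hsdef]; field_simp
        _ < d := by
          rw [div_lt_iff₀ (by positivity)]
          have h5 : K * l * l ≤ K * (2 * ρ) * (2 * d) := by
            gcongr
            linarith
          have h6 : ρ * (4 * K) * d < r ^ 2 * d := by gcongr
          linarith
    have hmem : (α ((z, u), s)).1 ∈ Zc := by
      have hb : (α ((z, u), s)).1 ∈ Metric.closedBall z₀ (2 * ρ) := by
        rw [Metric.mem_closedBall]
        have := dist_triangle (α ((z, u), s)).1 o z₀
        rw [dist_comm _ o] at this
        have := Metric.mem_ball.1 ho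
        linarith
      refine ⟨hb, ?_⟩
      have hzt : ((z, u) : E × E).1 ∈ (chartAt E y).target := hball hzZ.1
      have hsrc := (tbChart (M := M) y).map_target (mem_tbChart_target.2 hzt)
      have hflow := hΦ.eq_symm isVectorField_spray (σ := fun t ↦ α ((z, u), t)) (i := y)
        (n := (tbChart (M := M) y).symm (z, u))
        (fun t ht ↦ ⟨((hα _ hpU).2 t ht).1, ((hα _ hpU).2 t ht).2.1⟩) hsrc
        (by rw [(hα _ hpU).1, (tbChart (M := M) y).right_inv (mem_tbChart_target.2 hzt)])
        (hI s ⟨hs0, le_rfl⟩)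
      have hZξ := hinv ((tbChart (M := M) y).symm (z, u))
        (by rw [tbChart_symm_apply hzt]; exact hzZ.2) s
      rw [hflow, tbChart_symm_apply (hball hb)] at hZξ
      exact hZξ
    exact absurd (Metric.infDist_le_dist_of_mem hmem) (not_le.2 hpos)
  filter_upwards [(chartAt E y).open_source.mem_nhds hys,
    ((chartAt E y).continuousAt hys).preimage_mem_nhds (Metric.ball_mem_nhds z₀ hρ)] with x hx hxb
  have := (main _ hxb).2
  rwa [mem_preimage, (chartAt E y).left_inv hx] at this

/-! ### Propagating the existence time along geodesics -/

theorem flow_mem_liftDomain [CompleteSpace E] [T2Space M]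
    [IsContMDiffRiemannianBundle 𝓘(ℝ, E) ∞ E (fun x : M ↦ TangentSpace 𝓘(ℝ, E) x)]
    {F : ∀ x : M, TangentSpace 𝓘(ℝ, E) x} (hF : IsKillingField F)
    {Φ : TangentBundle 𝓘(ℝ, E) M → ℝ → TangentBundle 𝓘(ℝ, E) M}
    (hΦ : IsGlobalFlow (tbChart (M := M)) (fun c ↦ spray (metricInChart (E := E) c)) Φ) {ε : ℝ}
    {ξ : TangentBundle 𝓘(ℝ, E) M} (hξ : ξ ∈ liftDomain F ε) (s : ℝ) : Φ ξ s ∈ liftDomain F ε := by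
  obtain ⟨α, rfl, hα⟩ := hξ
  exact ⟨fun t ↦ Φ (α t) s, rfl, fun t ht ↦ (preservesAt exists_mem_tbChart_source
    isVectorField_spray (isVectorField_completeLift hF.contMDiff)
    (fun c _ hz ↦ fderiv_spray_completeLift_fieldInChart hF c hz) hΦ s (α t)).2 α t rfl (hα t ht)⟩

/-- On a geodesically complete manifold, the integral curves of a Killing field exist for a uniform
time. -/
theorem IsKillingField.exists_forall_mem_liftDomain [CompleteSpace E] [T2Space M] [ConnectedSpace M]
    [IsContMDiffRiemannianBundle 𝓘(ℝ, E) ∞ E (fun x : M ↦ TangentSpace 𝓘(ℝ, E) x)]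
    {F : ∀ x : M, TangentSpace 𝓘(ℝ, E) x} (hF : IsKillingField F)
    (hM : GeodesicallyComplete E M) : ∃ ε > 0, ∀ ξ, ξ ∈ liftDomain F ε := by
  obtain ⟨Φ, hΦ⟩ := hM.exists_isGlobalFlow
  have hX := isVectorField_completeLift hF.contMDiff
  obtain ⟨x₀⟩ := (inferInstance : Nonempty M)
  -- Local existence near a single zero vector fixes ε once and for all; fibrewise linearity extends
  -- it to whole fibres without shrinking ε.
  obtain ⟨c, hc⟩ := exists_mem_tbChart_source (⟨x₀, 0⟩ : TangentBundle 𝓘(ℝ, E) M)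
  obtain ⟨ε, hε, hloc⟩ := hX.exists_isSolAt_nhds hc
  set G := interior {x : M | ∀ v, (⟨x, v⟩ : TangentBundle 𝓘(ℝ, E) M) ∈ liftDomain F ε}
  have hx₀ : x₀ ∈ G :=
    mem_interior_iff_mem_nhds.2 (eventually_forall_mem_liftDomain hF.contMDiff hε hloc)
  have hinv : ∀ ξ : TangentBundle 𝓘(ℝ, E) M, ξ.proj ∈ Gᶜ → ∀ s, (Φ ξ s).proj ∈ Gᶜ := by
    intro ξ hξ s hs
    refine hξ (mem_interior_iff_mem_nhds.2 (eventually_forall_mem_liftDomain hF.contMDiff hε ?_))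
    -- The time `s` geodesic map sends all η near ξ over the open set `G`, hence into `liftDomain`;
    -- flowing back by `-s` puts η itself there.
    have hcont := (preservesAt exists_mem_tbChart_source isVectorField_spray hX
      (fun c _ hz ↦ fderiv_spray_completeLift_fieldInChart hF c hz) hΦ s ξ).1
    filter_upwards [hcont.preimage_mem_nhds ((isOpen_interior.preimage
      (FiberBundle.continuous_proj E (TangentSpace 𝓘(ℝ, E)))).mem_nhds hs)] with η hη
    have h1 : Φ η s ∈ liftDomain F ε := interior_subset hη (Φ η s).2
    have h2 := flow_mem_liftDomain hF hΦ h1 (-s)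
    rwa [← hΦ.add isVectorField_spray, neg_add_cancel, hΦ.zero] at h2
  have hZ := isOpen_of_isClosed_of_flow_invariant hΦ isOpen_interior.isClosed_compl hinv
  have hclopen : IsClopen G := ⟨isOpen_compl_iff.1 hZ, isOpen_interior⟩
  have huniv := hclopen.eq_univ ⟨x₀, hx₀⟩
  exact ⟨ε, hε, fun ξ ↦ interior_subset (huniv ▸ mem_univ ξ.proj : ξ.proj ∈ G) ξ.2⟩

end Riemannian

/-! ### From global integral curves to completeness -/

section Completeness

variable {E : Type*} [NormedAddCommGroup E] [NormedSpace ℝ E]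
  {M : Type*} [TopologicalSpace M] [T2Space M] [ChartedSpace E M] [IsManifold 𝓘(ℝ, E) ∞ M]

theorem isCompleteVectorField_of_forall_exists_isMIntegralCurve
    {F : ∀ x : M, TangentSpace 𝓘(ℝ, E) x}
    (hF : ContMDiff 𝓘(ℝ, E) 𝓘(ℝ, E).tangent 1 (fun x ↦ (⟨x, F x⟩ : TangentBundle 𝓘(ℝ, E) M)))
    (h : ∀ x, ∃ γ : ℝ → M, γ 0 = x ∧ IsMIntegralCurve γ F) : IsCompleteVectorField F := by
  intro γ s hγ
  obtain ⟨t₀, ht₀⟩ := hγ.nonempty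
  obtain ⟨δ', h0, hδ'⟩ := h (γ t₀)
  have hδ := hδ'.comp_add (-t₀)
  set δ := δ' ∘ (· + -t₀)
  have hδ0 : δ t₀ = γ t₀ := by simpa [δ] using h0
  refine (hγ.maximal δ univ isOpen_univ ordConnected_univ (hδ.isMIntegralCurveOn _)
    (subset_univ _) fun t ht ↦ ?_).symm
  have hsub : ∀ r ∈ s, ∃ l > 0, Ioo (r - l) (r + l) ⊆ s := fun r hr ↦ by
    obtain ⟨l, hl, hls⟩ := Metric.isOpen_iff.1 hγ.isOpen r hr
    exact ⟨l, hl, by rwa [← Real.ball_eq_Ioo]⟩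
  -- The uniqueness theorem is stated on bounded open intervals, so one containing both `t₀` and `t`
  -- is built inside `s`.
  obtain ⟨l, hl, hls⟩ := hsub _ (min_rec' (· ∈ s) ht₀ ht)
  obtain ⟨m, hm, hms⟩ := hsub _ (max_rec' (· ∈ s) ht₀ ht)
  have hIs : Ioo (min t₀ t - l) (max t₀ t + m) ⊆ s := by
    intro r hr
    have hle := min_le_max (a := t₀) (b := t)
    rcases lt_or_ge r (min t₀ t) with h1 | h1
    · exact hls ⟨hr.1, by linarith⟩
    rcases lt_or_ge (max t₀ t) r with h2 | h2
    · exact hms ⟨by linarith, hr.2⟩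
    · exact hγ.ordConnected.out (min_rec' (· ∈ s) ht₀ ht) (max_rec' (· ∈ s) ht₀ ht) ⟨h1, h2⟩
  refine isMIntegralCurveOn_Ioo_eqOn_of_contMDiff_boundaryless (t₀ := t₀) ?_ hF
    (hγ.isIntegralCurve.mono hIs) (hδ.isMIntegralCurveOn _) hδ0.symm ?_
  · exact ⟨by linarith [min_le_left t₀ t], by linarith [le_max_left t₀ t]⟩
  · exact ⟨by linarith [min_le_right t₀ t], by linarith [le_max_right t₀ t]⟩

end Completeness

end RiemannianKilling

end

theorem mainTheorem3 {E : Type*} [NormedAddCommGroup E] [NormedSpace ℝ E] [CompleteSpace E]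
    {M : Type*} [TopologicalSpace M] [T2Space M] [ConnectedSpace M]
    [ChartedSpace E M] [IsManifold 𝓘(ℝ, E) ∞ M]
    [RiemannianBundle (fun x : M ↦ TangentSpace 𝓘(ℝ, E) x)]
    [IsContMDiffRiemannianBundle 𝓘(ℝ, E) ∞ E (fun x : M ↦ TangentSpace 𝓘(ℝ, E) x)]
    (hM : RiemannianKilling.GeodesicallyComplete E M)
    (F : ∀ x : M, TangentSpace 𝓘(ℝ, E) x) (hF : RiemannianKilling.IsKillingField F) :
    RiemannianKilling.IsCompleteVectorField F := by
  obtain ⟨ε, hε, h⟩ := hF.exists_forall_mem_liftDomain hM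
  have hF1 : ContMDiff 𝓘(ℝ, E) 𝓘(ℝ, E).tangent 1
      (fun x ↦ (⟨x, F x⟩ : TangentBundle 𝓘(ℝ, E) M)) := hF.contMDiff.of_le (by simp)
  -- A uniform existence time extends every integral curve to all of ℝ. Any tangent vector at `x`
  -- would do for the lift; the zero vector is a convenient choice.
  exact RiemannianKilling.isCompleteVectorField_of_forall_exists_isMIntegralCurve hF1
    (exists_isMIntegralCurve_of_isMIntegralCurveOn hF1 hε fun x ↦
      RiemannianKilling.exists_isMIntegralCurveOn_of_mem_liftDomain hF.contMDiff (h ⟨x, 0⟩))
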